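/- Let $d\ge 1$, $\kappa>0$, $0<t_1<t_2$, let $\Gamma$ be a real symmetric positive definite $d\times d$ matrix and $y_0\in\mathbb R^d$. Let $Y$ be a $d$-dimensional Ornstein--Uhlenbeck (OU) process with parameters $\kappa,\Gamma$ started at $y_0$, i.e. the continuous solution of $$dY_t=-\kappa\,\Gamma\,Y_t\,dt+\sqrt{2\kappa}\,dW_t,\qquad Y_0=y_0,$$ where $W$ is a standard $d$-dimensional Brownian motion. For $t>0$ the law of $Y_t$ has the density $f(t,\cdot\mid y_0)$, where $f(t,\cdot\mid x)$ denotes the density of the normal law with mean $e^{-\kappa t\Gamma}x$ and covariance $\Sigma(t)=2\int_0^{\kappa t}e^{-\Gamma s}e^{-\Gamma^{\top}s}\,ds$. The entropy production on $[t_1,t_2]$ is $$\Delta s=\ln\frac{f(t_1,Y_{t_1}\mid y_0)\,f(t_2-t_1,Y_{t_2}\mid Y_{t_1})}{f(t_2,Y_{t_2}\mid y_0)\,f(t_2-t_1,Y_{t_1}\mid Y_{t_2})}.$$ (i) The law of $\Delta s$ has a density. Let $(e_r)_{r=1}^d$ be any orthonormal basis of eigenvectors of $\Gamma$ (the principal axes),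 $\Gamma e_r=\gamma_re_r$. Each $\langle e_r,Y\rangle$ is a one-dimensional OU process with parameters $\kappa,\gamma_r$, started at $\langle e_r,y_0\rangle$ and driven by $\langle e_r,W\rangle$; the entropy productions $\Delta s_r$ of these $d$ one-dimensional models are independent and $\Delta s=\sum_{r=1}^d\Delta s_r$. For any one-dimensional OU processes $Z^{(1)},\dots,Z^{(d)}$ (on arbitrary probability spaces) with rate $\kappa$, generators $\gamma_r$ and starting points $\langle e_r,y_0\rangle$, the entropy production of each $Z^{(r)}$ on $[t_1,t_2]$ has a density, and the law of $\Delta s$ is the $d$-fold convolution of their entropy production laws. Moreover, put $q_i^{(r)}=e^{-2\gamma_r\kappa t_i}$ and $$D_r(\lambda)=1+\big(q_1^{(r)}-q_2^{(r)}\big)\lambda-\frac{q_2^{(r)}\big(q_1^{(r)}-q_2^{(r)}\big)}{1-q_2^{(r)}}\lambda^2 .$$ If $\lambda\in\mathbb C$ satisfies $D_r(\operatorname{Re}\lambda)>0$ for all $r$, then $e^{\lambda\Delta s}$ is integrable and the moment-generating function factorises, $M_{\Delta s}(\lambda)=\prod_{r=1}^dM_r(\lambda)$, where $M_r$ is the moment-generating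 function of the $r$-th one-dimensional entropy production; and for each $r$ and each real $\lambda$ with $D_r(\lambda)>0$ the latter exists and $$M_r(\lambda)=\Big(\frac{1-q_2^{(r)}}{1-q_1^{(r)}}\Big)^{\lambda/2}D_r(\lambda)^{-1/2}\exp\Big(\frac{(q_1^{(r)}-q_2^{(r)})\,\lambda(\lambda+1)\,\gamma_r\langle e_r,y_0\rangle^2/2}{D_r(\lambda)}\Big).$$ (ii) In the isotropic case $\Gamma=\theta I$ with $y_0=0$, the law of $\Delta s$ has the density $$p(x)=\frac{(b^2-a^2)^{\nu+\frac12}}{\sqrt\pi\,\Gamma(\nu+\frac12)}\,e^{a(x-s^*)}\left|\frac{x-s^*}{2b}\right|^{\nu}K_\nu\big(b|x-s^*|\big),\qquad \nu=\frac{d-1}2,$$ (here $\Gamma(\cdot)$ is the Gamma function) with $K_\nu$ the modified Bessel function of the second kind, $q_i=e^{-2\theta\kappa t_i}$, and $$a=-\frac{1-q_2}{2q_2},\qquad b=\Big(\frac{1-q_2}{q_2(q_1-q_2)}+\Big(\frac{1-q_2}{2q_2}\Big)^2\Big)^{1/2},\qquad s^*=\frac d2\ln\frac{1-e^{-2\theta\kappa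 t_2}}{1-e^{-2\theta\kappa t_1}}.$$ -/

import Mathlib

open MeasureTheory ProbabilityTheory
open scoped NNReal Matrix

noncomputable section

namespace OU

/-- A standard `d`-dimensional Brownian motion: the coordinates are independent standard
one-dimensional Brownian motions. -/
structure IsBrownian {d : ℕ} {Ω : Type*} [MeasurableSpace Ω]
    (W : ℝ≥0 → Ω → EuclideanSpace ℝ (Fin d)) (P : Measure Ω) : Prop where
  measurable : ∀ t, Measurable (W t)
  coord : ∀ i, IsBrownianReal (fun t ω => W t ω i) P
  indep : iIndepFun (fun (i : Fin d) (ω : Ω) (t : ℝ≥0) => W t ω i) P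

/-- `Y` is a (continuous) solution of the stochastic differential equation
`dY_t = -κ Γ Y_t dt + √(2κ) dW_t` with the deterministic initial value `Y_0 = y₀`, where `W` is a
standard `d`-dimensional Brownian motion. The noise is additive, so the equation in integral form
contains no stochastic integral besides `W_t` itself. -/
structure IsOrnsteinUhlenbeck {d : ℕ} {Ω : Type*} [MeasurableSpace Ω]
    (κ : ℝ) (Γ : Matrix (Fin d) (Fin d) ℝ) (y₀ : EuclideanSpace ℝ (Fin d))
    (W Y : ℝ≥0 → Ω → EuclideanSpace ℝ (Fin d)) (P : Measure Ω) : Prop where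
  brownian : IsBrownian W P
  measurable : ∀ t, Measurable (Y t)
  cont : ∀ᵐ ω ∂P, Continuous (fun t => Y t ω)
  eqn : ∀ᵐ ω ∂P, ∀ t : ℝ≥0,
    Y t ω = y₀ - κ • (∫ s in (0 : ℝ)..t, Matrix.toEuclideanLin Γ (Y s.toNNReal ω))
      + √(2 * κ) • W t ω

/-- The covariance matrix `Σ(t) = 2 ∫₀^{κ t} e^{-Γ s} e^{-Γᵀ s} ds` of `Y_t`. -/
def covMatrix {d : ℕ} (κ : ℝ) (Γ : Matrix (Fin d) (Fin d) ℝ) (t : ℝ) :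
    Matrix (Fin d) (Fin d) ℝ :=
  Matrix.of fun i j =>
    2 * ∫ s in (0 : ℝ)..(κ * t), (NormedSpace.exp ((-s) • Γ) * NormedSpace.exp ((-s) • Γᵀ)) i j

/-- The transition density of the Ornstein-Uhlenbeck model: `transDensity κ Γ t x y` is the
density at `y`, a time `t` after a start at `x`, i.e. the density of the normal law with mean
`e^{-Γ κ t} x` and covariance matrix `Σ(t)`. -/
def transDensity {d : ℕ} (κ : ℝ) (Γ : Matrix (Fin d) (Fin d) ℝ) (t : ℝ)
    (x y : EuclideanSpace ℝ (Fin d)) : ℝ :=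
  let v : Fin d → ℝ := y.ofLp - NormedSpace.exp ((-(κ * t)) • Γ) *ᵥ x.ofLp
  1 / ((2 * Real.pi) ^ ((d : ℝ) / 2) * √(covMatrix κ Γ t).det)
    * Real.exp (-(1 / 2) * (v ⬝ᵥ ((covMatrix κ Γ t)⁻¹ *ᵥ v)))

/-- The stochastic entropy production of a transition from `y₁` at time `t₁` to `y₂` at time `t₂`,
for a model with transition density `f` (`f t x y`: from `x` to `y` in time `t`) started at `y₀`
at time `0`. -/
def entropyProduction {E : Type*} (f : ℝ → E → E → ℝ) (t₁ t₂ : ℝ) (y₀ y₁ y₂ : E) : ℝ :=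
  Real.log ((f t₁ y₀ y₁ * f (t₂ - t₁) y₁ y₂) / (f t₂ y₀ y₂ * f (t₂ - t₁) y₂ y₁))

/-- The entropy production `Δs` of the process `Y` between the times `t₁` and `t₂`, where `Y` is
an Ornstein-Uhlenbeck process with parameters `κ`, `Γ` started at `y₀`. -/
def entropy {d : ℕ} {Ω : Type*} (κ : ℝ) (Γ : Matrix (Fin d) (Fin d) ℝ)
    (y₀ : EuclideanSpace ℝ (Fin d)) (t₁ t₂ : ℝ≥0)
    (Y : ℝ≥0 → Ω → EuclideanSpace ℝ (Fin d)) (ω : Ω) : ℝ :=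
  entropyProduction (transDensity κ Γ) t₁ t₂ y₀ (Y t₁ ω) (Y t₂ ω)

/-- The `1 × 1` generator `(γ)` of a one-dimensional model. -/
def gen1 (γ : ℝ) : Matrix (Fin 1) (Fin 1) ℝ := γ • (1 : Matrix (Fin 1) (Fin 1) ℝ)

/-- The coordinate of `x` along the unit vector `e`, as a vector of the one-dimensional space. -/
def coordAlong {d : ℕ} (e x : EuclideanSpace ℝ (Fin d)) : EuclideanSpace ℝ (Fin 1) :=
  !₂[inner ℝ e x]

/-- The convolution of finitely many measures on `ℝ`. -/
def convolution {d : ℕ} (μ : Fin d → Measure ℝ) : Measure ℝ :=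
  (List.ofFn μ).foldr Measure.conv (Measure.dirac 0)

/-- `q = e^{-2 γ κ t}`. -/
def q (κ γ t : ℝ) : ℝ := Real.exp (-2 * γ * κ * t)

/-- `D(l) = 1 + (q₁ - q₂) l - q₂ (q₁ - q₂) / (1 - q₂) l²`. -/
def quadD (κ γ t₁ t₂ l : ℝ) : ℝ :=
  1 + (q κ γ t₁ - q κ γ t₂) * l
    - q κ γ t₂ * (q κ γ t₁ - q κ γ t₂) / (1 - q κ γ t₂) * l ^ 2

/-- The closed form of the moment-generating function of the one-dimensional entropy production,
with rate `κ`, generator `γ` and starting point `y`. -/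
def mgf1 (κ γ y t₁ t₂ l : ℝ) : ℝ :=
  ((1 - q κ γ t₂) / (1 - q κ γ t₁)) ^ (l / 2) * quadD κ γ t₁ t₂ l ^ (-(1 / 2) : ℝ)
    * Real.exp ((q κ γ t₁ - q κ γ t₂) * l * (l + 1) * (γ * y ^ 2 / 2) / quadD κ γ t₁ t₂ l)

/-- The modified Bessel function of the second kind, `K_ν(x) = ∫₀^∞ e^{-x cosh u} cosh(ν u) du`
for `x > 0`. -/
def besselK (ν x : ℝ) : ℝ :=
  ∫ u in Set.Ioi (0 : ℝ), Real.exp (-x * Real.cosh u) * Real.cosh (ν * u)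

/-- The density of the `K`-distribution (variance-gamma distribution) of order `ν` with parameters
`a`, `b`. -/
def kDensity (ν a b x : ℝ) : ℝ :=
  (b ^ 2 - a ^ 2) ^ (ν + 1 / 2) / (√Real.pi * Real.Gamma (ν + 1 / 2))
    * Real.exp (a * x) * |x / (2 * b)| ^ ν * besselK ν (b * |x|)

/-- The parameter `a = -(1 - q₂) / (2 q₂)`. -/
def parA (κ θ t₂ : ℝ) : ℝ := -(1 - q κ θ t₂) / (2 * q κ θ t₂)

/-- The parameter `b = ((1 - q₂) / (q₂ (q₁ - q₂)) + ((1 - q₂) / (2 q₂))²)^{1/2}`. -/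
def parB (κ θ t₁ t₂ : ℝ) : ℝ :=
  √((1 - q κ θ t₂) / (q κ θ t₂ * (q κ θ t₁ - q κ θ t₂)) + ((1 - q κ θ t₂) / (2 * q κ θ t₂)) ^ 2)

end OU

end

noncomputable section

namespace OU

/-! ### Diagonalization of the transition density -/

/-! The spectral theorem reduces everything to dimension one. In an orthonormal eigenbasis of `Γ`
the mean, the determinant and the quadratic form of the transition density split, so the density is
a product of one-dimensional Gaussian densities (`transDensity_eq_prod`) and the logarithmic ratio
is a sum. The rotated coordinates of Brownian motion are jointly Gaussian and uncorrelated, hence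
independent (`IsBrownian.iIndepFun_inner`).

Passing from `W` to `Y` needs no stochastic integral: the noise is additive, and summation by parts
shows, path by path, that the Riemann sums of `∫ e^{-c(t-s)} dw_s` converge (`tendsto_ouSum`). A
solution is therefore almost surely a measurable functional of its driving path; characteristic
functions give its law, and restarting at `t₁` produces an increment independent of the past
(`IsOURaw.map_pair_eq_prod`).

In the centred value `ξ` at `t₁` and the increment `v`, the one-dimensional entropy production is a
quadratic polynomial. Its coefficient of `v²` is a nonzero constant, which makes the law absolutely
continuous; two successive Gaussian integrations give the closed form `mgf1` wherever `D > 0`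
(`lintegral_exp_entropyFun`). Independence turns these facts into a convolution of laws and a
product of moment-generating functions.

In the isotropic case from the origin, the moment-generating function is `e^{l s*} D(l)^{-d/2}`. The
`K`-distribution is a gamma mixture of normal laws, and `a`, `b` are such that its moment-generating
function is the same (`parB_sq_sub_parA_sq_sub`). Agreement near `0` identifies the laws
(`ext_of_mgf_eq_near_zero`). -/

/-- The variance at time `t` of the one-dimensional model. -/
def ouVar (κ γ t : ℝ) : ℝ := (1 - q κ γ t) / γ

lemma q_lt_one {κ γ t : ℝ} (hκ : 0 < κ) (hγ : 0 < γ) (ht : 0 < t) : q κ γ t < 1 := by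
  unfold q
  rw [Real.exp_lt_one_iff]
  have : 0 < γ * κ * t := by positivity
  linarith

lemma q_pos (κ γ t : ℝ) : 0 < q κ γ t := Real.exp_pos _

lemma q_lt_q {κ γ s t : ℝ} (hκ : 0 < κ) (hγ : 0 < γ) (hst : s < t) : q κ γ t < q κ γ s := by
  unfold q
  rw [Real.exp_lt_exp]
  have : 0 < γ * κ * (t - s) := mul_pos (by positivity) (sub_pos.2 hst)
  linarith

lemma ouVar_pos {κ γ t : ℝ} (hκ : 0 < κ) (hγ : 0 < γ) (ht : 0 < t) : 0 < ouVar κ γ t :=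
  div_pos (sub_pos.2 (q_lt_one hκ hγ ht)) hγ

/-- The orthogonal matrix whose columns are the vectors of an orthonormal basis. -/
def basisMatrix {d : ℕ} (e : OrthonormalBasis (Fin d) ℝ (EuclideanSpace ℝ (Fin d))) :
    Matrix (Fin d) (Fin d) ℝ := Matrix.of fun i r => e r i

section Diagonal

variable {d : ℕ} (e : OrthonormalBasis (Fin d) ℝ (EuclideanSpace ℝ (Fin d)))

lemma basisMatrix_transpose_mul_self : (basisMatrix e)ᵀ * basisMatrix e = 1 := by
  ext r s
  have h := orthonormal_iff_ite.1 e.orthonormal r s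
  rw [PiLp.inner_apply] at h
  simp only [RCLike.inner_apply, conj_trivial] at h
  rw [Matrix.mul_apply, Matrix.one_apply, ← h]
  exact Finset.sum_congr rfl fun i _ => by simp [basisMatrix, mul_comm]

lemma basisMatrix_mul_transpose_self : basisMatrix e * (basisMatrix e)ᵀ = 1 :=
  mul_eq_one_comm.1 (basisMatrix_transpose_mul_self e)

lemma basisMatrix_inv : (basisMatrix e)⁻¹ = (basisMatrix e)ᵀ :=
  Matrix.inv_eq_left_inv (basisMatrix_transpose_mul_self e)

lemma isUnit_basisMatrix : IsUnit (basisMatrix e) :=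
  ⟨⟨_, _, basisMatrix_mul_transpose_self e, basisMatrix_transpose_mul_self e⟩, rfl⟩

lemma basisMatrix_transpose_mulVec (x : EuclideanSpace ℝ (Fin d)) (r : Fin d) :
    ((basisMatrix e)ᵀ *ᵥ x.ofLp) r = inner ℝ (e r) x := by
  rw [PiLp.inner_apply]
  simp only [Matrix.mulVec, dotProduct, RCLike.inner_apply, conj_trivial]
  exact Finset.sum_congr rfl fun i _ => by simp [basisMatrix, mul_comm]

variable {e} {Γ : Matrix (Fin d) (Fin d) ℝ} {γ : Fin d → ℝ}

lemma eq_conj_diagonal (he : ∀ r, Matrix.toEuclideanLin Γ (e r) = γ r • e r) :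
    Γ = basisMatrix e * Matrix.diagonal γ * (basisMatrix e)ᵀ := by
  have h : Γ * basisMatrix e = basisMatrix e * Matrix.diagonal γ := by
    ext i r
    have h := congrArg (fun v : EuclideanSpace ℝ (Fin d) => v i) (he r)
    simp only [Matrix.toLpLin_apply, PiLp.smul_apply, smul_eq_mul] at h
    rw [Matrix.mul_diagonal, mul_comm]
    exact h
  rw [← h, Matrix.mul_assoc, basisMatrix_mul_transpose_self, Matrix.mul_one]

lemma exp_smul_eq_conj (he : ∀ r, Matrix.toEuclideanLin Γ (e r) = γ r • e r) (s : ℝ) :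
    NormedSpace.exp (s • Γ) = basisMatrix e * Matrix.diagonal (fun r => Real.exp (s * γ r)) *
      (basisMatrix e)ᵀ := by
  rw [eq_conj_diagonal he, ← basisMatrix_inv]
  have h : s • (basisMatrix e * Matrix.diagonal γ * (basisMatrix e)⁻¹) =
      basisMatrix e * Matrix.diagonal (s • γ) * (basisMatrix e)⁻¹ := by
    rw [Matrix.diagonal_smul, Matrix.mul_smul, Matrix.smul_mul]
  rw [h, Matrix.exp_conj _ _ (isUnit_basisMatrix e), Matrix.exp_diagonal]
  congr
  ext r
  rw [Pi.coe_exp, Real.exp_eq_exp_ℝ]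
  rfl

lemma transpose_eq_self (he : ∀ r, Matrix.toEuclideanLin Γ (e r) = γ r • e r) : Γᵀ = Γ := by
  rw [eq_conj_diagonal he]
  simp [Matrix.transpose_mul, Matrix.mul_assoc]

lemma conj_diagonal_apply (δ : Fin d → ℝ) (i j : Fin d) :
    (basisMatrix e * Matrix.diagonal δ * (basisMatrix e)ᵀ) i j =
      ∑ r, basisMatrix e i r * basisMatrix e j r * δ r := by
  rw [Matrix.mul_apply]
  refine Finset.sum_congr rfl fun r _ => ?_
  rw [Matrix.mul_diagonal, Matrix.transpose_apply]
  ring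

lemma conj_diagonal_mul (δ ε : Fin d → ℝ) :
    (basisMatrix e * Matrix.diagonal δ * (basisMatrix e)ᵀ) *
      (basisMatrix e * Matrix.diagonal ε * (basisMatrix e)ᵀ) =
      basisMatrix e * Matrix.diagonal (fun r => δ r * ε r) * (basisMatrix e)ᵀ := by
  calc _ = basisMatrix e * Matrix.diagonal δ * ((basisMatrix e)ᵀ * basisMatrix e) *
        Matrix.diagonal ε * (basisMatrix e)ᵀ := by simp only [Matrix.mul_assoc]
    _ = _ := by
      rw [basisMatrix_transpose_mul_self, Matrix.mul_one, Matrix.mul_assoc (basisMatrix e),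
        Matrix.diagonal_mul_diagonal]

lemma two_mul_integral_exp {γ : ℝ} (hγ : γ ≠ 0) (κ t : ℝ) :
    2 * ∫ s in (0 : ℝ)..(κ * t), Real.exp (-s * γ) * Real.exp (-s * γ) = ouVar κ γ t := by
  have h : ∀ s ∈ Set.uIcc 0 (κ * t), HasDerivAt (fun s => -(Real.exp (-2 * γ * s) / (2 * γ)))
      (Real.exp (-s * γ) * Real.exp (-s * γ)) s := by
    intro s _
    have h1 : HasDerivAt (fun s : ℝ => -2 * γ * s) (-2 * γ) s := by
      simpa using (hasDerivAt_id s).const_mul (-2 * γ)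
    refine (h1.exp.div_const (2 * γ)).neg.congr_deriv ?_
    rw [← Real.exp_add, show -s * γ + -s * γ = -2 * γ * s by ring]
    field_simp
  rw [intervalIntegral.integral_eq_sub_of_hasDerivAt h
    (Continuous.intervalIntegrable (by fun_prop) _ _)]
  simp only [ouVar, q, mul_zero, Real.exp_zero, mul_assoc]
  field_simp
  ring

/-- Having an orthonormal eigenbasis forces `Γᵀ = Γ`, so both exponentials are diagonal in the same
basis and the entrywise integral acts on the eigenvalues alone. -/
lemma covMatrix_eq_conj (he : ∀ r, Matrix.toEuclideanLin Γ (e r) = γ r • e r)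
    (hγ : ∀ r, γ r ≠ 0) (κ t : ℝ) :
    covMatrix κ Γ t =
      basisMatrix e * Matrix.diagonal (fun r => ouVar κ (γ r) t) * (basisMatrix e)ᵀ := by
  ext i j
  rw [conj_diagonal_apply]
  simp only [covMatrix, Matrix.of_apply, transpose_eq_self he, exp_smul_eq_conj he,
    conj_diagonal_mul, conj_diagonal_apply]
  rw [intervalIntegral.integral_finsetSum
    (fun r _ => Continuous.intervalIntegrable (by fun_prop) _ _), Finset.mul_sum]
  refine Finset.sum_congr rfl fun r _ => ?_
  rw [intervalIntegral.integral_const_mul, ← two_mul_integral_exp (hγ r)]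
  ring

lemma det_conj_diagonal (δ : Fin d → ℝ) :
    (basisMatrix e * Matrix.diagonal δ * (basisMatrix e)ᵀ).det = ∏ r, δ r := by
  rw [Matrix.mul_assoc, Matrix.det_mul_comm, Matrix.mul_assoc, basisMatrix_transpose_mul_self,
    Matrix.mul_one, Matrix.det_diagonal]

lemma inv_conj_diagonal {δ : Fin d → ℝ} (hδ : ∀ r, δ r ≠ 0) :
    (basisMatrix e * Matrix.diagonal δ * (basisMatrix e)ᵀ)⁻¹ =
      basisMatrix e * Matrix.diagonal (fun r => (δ r)⁻¹) * (basisMatrix e)ᵀ := by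
  apply Matrix.inv_eq_right_inv
  rw [conj_diagonal_mul]
  simp [hδ, basisMatrix_mul_transpose_self]

lemma transpose_mulVec_conj_diagonal_mulVec (δ v : Fin d → ℝ) (r : Fin d) :
    ((basisMatrix e)ᵀ *ᵥ ((basisMatrix e * Matrix.diagonal δ * (basisMatrix e)ᵀ) *ᵥ v)) r =
      δ r * ((basisMatrix e)ᵀ *ᵥ v) r := by
  rw [Matrix.mulVec_mulVec, ← Matrix.mul_assoc, ← Matrix.mul_assoc,
    basisMatrix_transpose_mul_self, Matrix.one_mul, ← Matrix.mulVec_mulVec, Matrix.mulVec_diagonal]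

lemma dotProduct_conj_diagonal_mulVec (δ v : Fin d → ℝ) :
    v ⬝ᵥ ((basisMatrix e * Matrix.diagonal δ * (basisMatrix e)ᵀ) *ᵥ v) =
      ∑ r, δ r * ((basisMatrix e)ᵀ *ᵥ v) r ^ 2 := by
  rw [← Matrix.mulVec_mulVec, ← Matrix.mulVec_mulVec, Matrix.dotProduct_mulVec,
    ← Matrix.mulVec_transpose, dotProduct]
  refine Finset.sum_congr rfl fun r _ => ?_
  rw [Matrix.mulVec_diagonal]
  ring

/-- Conjugation by the orthogonal matrix diagonalises mean, covariance and inverse covariance at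
once, so the normaliser and the exponent split over the axes. -/
theorem transDensity_eq_prod (he : ∀ r, Matrix.toEuclideanLin Γ (e r) = γ r • e r)
    {κ t : ℝ} (hκ : 0 < κ) (hγ : ∀ r, 0 < γ r) (ht : 0 < t) (x y : EuclideanSpace ℝ (Fin d)) :
    transDensity κ Γ t x y = ∏ r, gaussianPDFReal (Real.exp (-(κ * γ r * t)) * inner ℝ (e r) x)
      (ouVar κ (γ r) t).toNNReal (inner ℝ (e r) y) := by
  have hσ : ∀ r, 0 < ouVar κ (γ r) t := fun r => ouVar_pos hκ (hγ r) ht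
  have hv : ∀ r, ((basisMatrix e)ᵀ *ᵥ (y.ofLp - NormedSpace.exp ((-(κ * t)) • Γ) *ᵥ x.ofLp)) r =
      inner ℝ (e r) y - Real.exp (-(κ * γ r * t)) * inner ℝ (e r) x := by
    intro r
    rw [Matrix.mulVec_sub, Pi.sub_apply, exp_smul_eq_conj he,
      transpose_mulVec_conj_diagonal_mulVec, basisMatrix_transpose_mulVec,
      basisMatrix_transpose_mulVec]
    congr 3
    ring
  unfold transDensity
  simp only [covMatrix_eq_conj he (fun r => (hγ r).ne'), det_conj_diagonal,
    inv_conj_diagonal (fun r => (hσ r).ne'), dotProduct_conj_diagonal_mulVec, hv,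
    gaussianPDFReal, Real.coe_toNNReal _ (hσ _).le]
  rw [Finset.prod_mul_distrib, ← Real.exp_sum]
  congr 1
  · rw [Finset.prod_inv_distrib, one_div]
    congr 1
    -- One factor `√(2π)` is handed to each axis.
    have h2 : (2 * Real.pi) ^ ((d : ℝ) / 2) = √(2 * Real.pi) ^ d := by
      rw [Real.sqrt_eq_rpow, ← Real.rpow_natCast, ← Real.rpow_mul (by positivity)]
      congr 1
      ring
    rw [h2, Real.sqrt_eq_rpow (∏ r, _), ← Real.finsetProd_rpow _ _ (fun r _ => (hσ r).le)]
    simp only [← Real.sqrt_eq_rpow]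
    rw [Finset.prod_congr rfl (fun r _ => Real.sqrt_mul (by positivity : 0 ≤ 2 * Real.pi) _),
      Finset.prod_mul_distrib]
    simp
  · congr 1
    rw [Finset.mul_sum]
    refine Finset.sum_congr rfl fun r _ => ?_
    have := (hσ r).ne'
    field_simp

end Diagonal

/-! ### The one-dimensional transition density and entropy production -/

lemma gen1_eigen (γ : ℝ) (r : Fin 1) :
    Matrix.toEuclideanLin (gen1 γ) (EuclideanSpace.basisFun (Fin 1) ℝ r) =
      γ • EuclideanSpace.basisFun (Fin 1) ℝ r := by
  rw [gen1, map_smul, LinearMap.smul_apply]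
  congr 1
  rw [Matrix.toLpLin_apply, Matrix.one_mulVec]

theorem transDensity_gen1 {κ γ t : ℝ} (hκ : 0 < κ) (hγ : 0 < γ) (ht : 0 < t)
    (x y : EuclideanSpace ℝ (Fin 1)) :
    transDensity κ (gen1 γ) t x y = gaussianPDFReal (Real.exp (-(κ * γ * t)) * x 0)
      (ouVar κ γ t).toNNReal (y 0) := by
  rw [transDensity_eq_prod (e := EuclideanSpace.basisFun (Fin 1) ℝ) (γ := fun _ => γ)
    (gen1_eigen γ) hκ (fun _ => hγ) ht]
  simp [EuclideanSpace.inner_single_left]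

/-- The entropy production of the one-dimensional model, in real coordinates. -/
def entropy1 (κ γ x t₁ t₂ : ℝ) (y₁ y₂ : ℝ) : ℝ :=
  1 / 2 * Real.log ((1 - q κ γ t₂) / (1 - q κ γ t₁))
    - γ * (y₁ - Real.exp (-(κ * γ * t₁)) * x) ^ 2 / (2 * (1 - q κ γ t₁))
    + γ * (y₂ - Real.exp (-(κ * γ * t₂)) * x) ^ 2 / (2 * (1 - q κ γ t₂))
    + γ / 2 * (y₁ ^ 2 - y₂ ^ 2)

lemma log_gaussianPDFReal (m x : ℝ) {v : ℝ} (hv : 0 < v) :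
    Real.log (gaussianPDFReal m v.toNNReal x) =
      -(1 / 2) * Real.log (2 * Real.pi * v) - (x - m) ^ 2 / (2 * v) := by
  rw [gaussianPDFReal, Real.coe_toNNReal _ hv.le, Real.log_mul (by positivity) (by positivity),
    Real.log_inv, Real.log_exp, Real.log_sqrt (by positivity)]
  ring

lemma q_eq_sq (κ γ t : ℝ) : q κ γ t = Real.exp (-(κ * γ * t)) ^ 2 := by
  rw [q, ← Real.exp_nat_mul]
  congr 1
  push_cast
  ring

/-- The forward and backward transitions over `t₂ - t₁` have equal variance, so their normalisers
cancel; only the variances at `t₁` and `t₂` leave a logarithm. -/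
lemma entropyProduction_gaussianPDFReal {κ γ t₁ t₂ : ℝ} (hκ : 0 < κ) (hγ : 0 < γ) (ht₁ : 0 < t₁)
    (ht : t₁ < t₂) (x y₁ y₂ : ℝ) :
    entropyProduction (fun t a b => gaussianPDFReal (Real.exp (-(κ * γ * t)) * a)
      (ouVar κ γ t).toNNReal b) t₁ t₂ x y₁ y₂ = entropy1 κ γ x t₁ t₂ y₁ y₂ := by
  have h1 := ouVar_pos hκ hγ ht₁
  have h2 := ouVar_pos hκ hγ (ht₁.trans ht)
  have h3 := ouVar_pos hκ hγ (sub_pos.2 ht)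
  have hp : ∀ m b {v : ℝ}, 0 < v → gaussianPDFReal m v.toNNReal b ≠ 0 := fun m b v hv =>
    (gaussianPDFReal_pos m _ b (by simpa using hv)).ne'
  unfold entropyProduction
  rw [Real.log_div (mul_ne_zero (hp _ _ h1) (hp _ _ h3)) (mul_ne_zero (hp _ _ h2) (hp _ _ h3)),
    Real.log_mul (hp _ _ h1) (hp _ _ h3), Real.log_mul (hp _ _ h2) (hp _ _ h3),
    log_gaussianPDFReal _ _ h1, log_gaussianPDFReal _ _ h2, log_gaussianPDFReal _ _ h3,
    log_gaussianPDFReal _ _ h3]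
  have q1 := sub_pos.2 (q_lt_one hκ hγ ht₁)
  have q2 := sub_pos.2 (q_lt_one hκ hγ (ht₁.trans ht))
  have q3 := sub_pos.2 (q_lt_one hκ hγ (sub_pos.2 ht))
  rw [Real.log_mul (by positivity) h1.ne', Real.log_mul (by positivity) h2.ne']
  unfold entropy1
  rw [Real.log_div q2.ne' q1.ne']
  unfold ouVar
  rw [Real.log_div q2.ne' hγ.ne', Real.log_div q1.ne' hγ.ne']
  -- Detailed balance for the invariant weight `e^{-γ y² / 2}`: the backward and forward exponents
  -- differ by a function of the endpoints which no longer involves `t₂ - t₁`.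
  have key : (y₂ - Real.exp (-(κ * γ * (t₂ - t₁))) * y₁) ^ 2 / (2 * ((1 - q κ γ (t₂ - t₁)) / γ))
      - (y₁ - Real.exp (-(κ * γ * (t₂ - t₁))) * y₂) ^ 2 / (2 * ((1 - q κ γ (t₂ - t₁)) / γ))
      = γ / 2 * (y₂ ^ 2 - y₁ ^ 2) := by
    rw [← sub_div, div_eq_iff (by positivity)]
    field_simp
    rw [q_eq_sq]
    ring
  have e1 : ∀ z w : ℝ, z ^ 2 / (2 * (w / γ)) = γ * z ^ 2 / (2 * w) := by
    intro z w
    rw [← mul_div_assoc, div_div_eq_mul_div]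
    ring
  rw [e1, e1] at key ⊢
  rw [e1, e1]
  linarith

lemma entropy_gen1 {κ γ : ℝ} {t₁ t₂ : ℝ≥0} (hκ : 0 < κ) (hγ : 0 < γ) (ht₁ : 0 < t₁)
    (ht : t₁ < t₂) {Ω : Type*} [MeasurableSpace Ω] (x : EuclideanSpace ℝ (Fin 1))
    (Y : ℝ≥0 → Ω → EuclideanSpace ℝ (Fin 1)) (ω : Ω) :
    entropy κ (gen1 γ) x t₁ t₂ Y ω = entropy1 κ γ (x 0) t₁ t₂ (Y t₁ ω 0) (Y t₂ ω 0) := by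
  have h1 : (0 : ℝ) < t₁ := ht₁
  have h2 : (t₁ : ℝ) < t₂ := ht
  rw [← entropyProduction_gaussianPDFReal hκ hγ h1 h2]
  unfold entropy entropyProduction
  rw [transDensity_gen1 hκ hγ h1, transDensity_gen1 hκ hγ (h1.trans h2),
    transDensity_gen1 hκ hγ (sub_pos.2 h2), transDensity_gen1 hκ hγ (sub_pos.2 h2)]

lemma entropy_eq_sum {d : ℕ} {e : OrthonormalBasis (Fin d) ℝ (EuclideanSpace ℝ (Fin d))}
    {Γ : Matrix (Fin d) (Fin d) ℝ} {γ : Fin d → ℝ}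
    (he : ∀ r, Matrix.toEuclideanLin Γ (e r) = γ r • e r)
    {κ : ℝ} {t₁ t₂ : ℝ≥0} (hκ : 0 < κ) (hγ : ∀ r, 0 < γ r) (ht₁ : 0 < t₁)
    (ht : t₁ < t₂) {Ω : Type*} [MeasurableSpace Ω] (x : EuclideanSpace ℝ (Fin d))
    (Y : ℝ≥0 → Ω → EuclideanSpace ℝ (Fin d)) (ω : Ω) :
    entropy κ Γ x t₁ t₂ Y ω =
      ∑ r, entropy1 κ (γ r) (inner ℝ (e r) x) t₁ t₂ (inner ℝ (e r) (Y t₁ ω))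
        (inner ℝ (e r) (Y t₂ ω)) := by
  have h1 : (0 : ℝ) < t₁ := ht₁
  have h2 : (t₁ : ℝ) < t₂ := ht
  have hp : ∀ (t : ℝ) (m b : Fin d → ℝ), 0 < t →
      ∀ r ∈ Finset.univ, gaussianPDFReal (m r) (ouVar κ (γ r) t).toNNReal (b r) ≠ 0 :=
    fun t m b h r _ => (gaussianPDFReal_pos _ _ _ (by simpa using ouVar_pos hκ (hγ r) h)).ne'
  unfold entropy entropyProduction
  rw [transDensity_eq_prod he hκ hγ h1, transDensity_eq_prod he hκ hγ (h1.trans h2),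
    transDensity_eq_prod he hκ hγ (sub_pos.2 h2), transDensity_eq_prod he hκ hγ (sub_pos.2 h2),
    ← Finset.prod_mul_distrib, ← Finset.prod_mul_distrib, ← Finset.prod_div_distrib,
    Real.log_prod]
  · refine Finset.sum_congr rfl fun r _ => ?_
    rw [← entropyProduction_gaussianPDFReal hκ (hγ r) h1 h2]
    rfl
  · intro r hr
    exact div_ne_zero
      (mul_ne_zero (hp _ (fun _ => _) (fun _ => _) h1 r hr)
        (hp _ (fun _ => _) (fun _ => _) (sub_pos.2 h2) r hr))
      (mul_ne_zero (hp _ (fun _ => _) (fun _ => _) (h1.trans h2) r hr)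
        (hp _ (fun _ => _) (fun _ => _) (sub_pos.2 h2) r hr))

open Filter Topology

/-! ### The one-dimensional Ornstein-Uhlenbeck equation -/

/-- The `k`-th point of the partition of `[0, t]` into `n + 1` intervals. -/
def node (t : ℝ≥0) (n k : ℕ) : ℝ≥0 := t * k / (n + 1)

/-- Riemann sums of the Wiener integral `∫₀ᵗ e^{-c (t - s)} dw_s`. -/
def ouSum (c : ℝ) (t : ℝ≥0) (n : ℕ) (w : ℝ≥0 → ℝ) : ℝ :=
  ∑ k ∈ Finset.range (n + 1),
    Real.exp (-(c * (t - node t n k))) * (w (node t n (k + 1)) - w (node t n k))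

/-- The Wiener integral `∫₀ᵗ e^{-c (t - s)} dw_s`, as a measurable functional of the path. -/
def ouLim (c : ℝ) (t : ℝ≥0) (w : ℝ≥0 → ℝ) : ℝ := limsup (fun n => ouSum c t n w) atTop

lemma node_zero (t : ℝ≥0) (n : ℕ) : node t n 0 = 0 := by simp [node]

lemma node_last (t : ℝ≥0) (n : ℕ) : node t n (n + 1) = t := by
  unfold node
  push_cast
  field_simp

lemma node_mono (t : ℝ≥0) (n : ℕ) : Monotone (node t n) := by
  intro j k h
  unfold node
  gcongr

lemma node_le {t : ℝ≥0} {n k : ℕ} (hk : k ≤ n + 1) : node t n k ≤ t :=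
  (node_mono t n hk).trans (node_last t n).le

lemma coe_node_succ_sub (t : ℝ≥0) (n k : ℕ) :
    (node t n (k + 1) : ℝ) - node t n k = t / (n + 1) := by
  unfold node
  push_cast
  ring

lemma measurable_ouSum (c : ℝ) (t : ℝ≥0) (n : ℕ) : Measurable (ouSum c t n) := by
  unfold ouSum
  fun_prop

/-- Taking a `limsup` makes the functional defined and measurable on all paths; it is the limit on
those that drive a continuous solution with `σ ≠ 0`. -/
lemma measurable_ouLim (c : ℝ) (t : ℝ≥0) : Measurable (ouLim c t) :=
  Measurable.limsup fun n => measurable_ouSum c t n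

/-- All nodes lie in `[0, t]`. This adaptedness is what makes `X t` a function of the past of the
Brownian motion. -/
lemma ouLim_congr {c : ℝ} {t : ℝ≥0} {w w' : ℝ≥0 → ℝ} (h : ∀ s ≤ t, w s = w' s) :
    ouLim c t w = ouLim c t w' := by
  unfold ouLim
  congr 1
  ext n
  refine Finset.sum_congr rfl fun k hk => ?_
  have hk := Finset.mem_range.1 hk
  rw [h _ (node_le (by omega)), h _ (node_le (by omega))]

/-- Summation by parts for a path which satisfies the Ornstein-Uhlenbeck equation. -/
lemma smul_ouSum_sub_eq {c σ x₀ : ℝ} {x b : ℝ≥0 → ℝ} (hx : Continuous x)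
    (h : ∀ s : ℝ≥0, x s = x₀ - c * (∫ u in (0 : ℝ)..s, x u.toNNReal) + σ * b s)
    (t : ℝ≥0) (n : ℕ) :
    σ * ouSum c t n b - (x t - Real.exp (-(c * t)) * x 0) =
      ∑ k ∈ Finset.range (n + 1), ∫ s in (node t n k : ℝ)..(node t n (k + 1)),
        c * (Real.exp (-(c * (t - node t n k))) * x s.toNNReal
          - x (node t n (k + 1)) * Real.exp (-(c * (t - s)))) := by
  have hX : Continuous fun u : ℝ => x u.toNNReal := by fun_prop
  -- Telescoping of `s ↦ e^{-c(t-s)} x(s)` along the partition.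
  have htel : x t - Real.exp (-(c * t)) * x 0 = ∑ k ∈ Finset.range (n + 1),
      (Real.exp (-(c * (t - node t n (k + 1)))) * x (node t n (k + 1))
        - Real.exp (-(c * (t - node t n k))) * x (node t n k)) := by
    rw [Finset.sum_range_sub fun k => Real.exp (-(c * (t - node t n k))) * x (node t n k),
      node_last, node_zero]
    simp
  rw [htel, ouSum, Finset.mul_sum, ← Finset.sum_sub_distrib]
  refine Finset.sum_congr rfl fun k _ => ?_
  have hG : ∀ a b : ℝ, ∫ s in a..b, c * Real.exp (-(c * (t - s))) =
      Real.exp (-(c * (t - b))) - Real.exp (-(c * (t - a))) := by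
    intro a b
    refine intervalIntegral.integral_eq_sub_of_hasDerivAt
      (f := fun s => Real.exp (-(c * (t - s)))) (fun s _ => ?_)
      (Continuous.intervalIntegrable (by fun_prop) _ _)
    have h1 : HasDerivAt (fun s : ℝ => -(c * (t - s))) c s :=
      (((hasDerivAt_id s).const_sub (t : ℝ)).const_mul c).neg.congr_deriv (by ring)
    simpa [mul_comm] using h1.exp
  -- The equation at two consecutive nodes trades the noise increment for an increment of `x` and an
  -- ordinary integral.
  have hb : σ * (b (node t n (k + 1)) - b (node t n k)) = x (node t n (k + 1)) - x (node t n k)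
      + c * ∫ s in (node t n k : ℝ)..(node t n (k + 1)), x s.toNNReal := by
    rw [← intervalIntegral.integral_interval_sub_left (hX.intervalIntegrable 0 _)
      (hX.intervalIntegrable 0 _)]
    linear_combination h (node t n k) - h (node t n (k + 1))
  have e : (fun s : ℝ => c * (Real.exp (-(c * (t - node t n k))) * x s.toNNReal
        - x (node t n (k + 1)) * Real.exp (-(c * (t - s))))) = fun s : ℝ =>
      c * Real.exp (-(c * (t - node t n k))) * x s.toNNReal
        - x (node t n (k + 1)) * (c * Real.exp (-(c * (t - s)))) := by
    ext s; ring
  rw [e, intervalIntegral.integral_sub (Continuous.intervalIntegrable (by fun_prop) _ _)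
    (Continuous.intervalIntegrable (by fun_prop) _ _), intervalIntegral.integral_const_mul,
    intervalIntegral.integral_const_mul, hG]
  linear_combination Real.exp (-(c * (t - node t n k))) * hb

/-- The Riemann sums of the driving path converge for every path which satisfies the
Ornstein-Uhlenbeck equation. -/
theorem tendsto_ouSum {c σ x₀ : ℝ} {x b : ℝ≥0 → ℝ} (hx : Continuous x)
    (h : ∀ s : ℝ≥0, x s = x₀ - c * (∫ u in (0 : ℝ)..s, x u.toNNReal) + σ * b s) (t : ℝ≥0) :
    Tendsto (fun n => σ * ouSum c t n b) atTop (𝓝 (x t - Real.exp (-(c * t)) * x 0)) := by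
  rw [tendsto_iff_norm_sub_tendsto_zero, Metric.tendsto_atTop]
  intro ε hε
  set K : Set (ℝ × ℝ × ℝ) := Set.Icc 0 (t : ℝ) ×ˢ Set.Icc 0 (t : ℝ) ×ˢ Set.Icc 0 (t : ℝ)
  have hK : IsCompact K := isCompact_Icc.prod (isCompact_Icc.prod isCompact_Icc)
  -- `H` separates the left node, the right node and the integration variable. It vanishes on the
  -- diagonal, so uniform continuity on the cube makes the error small for a fine mesh.
  set H : ℝ × ℝ × ℝ → ℝ := fun p => c * (Real.exp (-(c * (t - p.1))) * x p.2.2.toNNReal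
    - x p.2.1.toNNReal * Real.exp (-(c * (t - p.2.2)))) with hH
  have hHc : Continuous H := by fun_prop
  -- With `ε / (t + 1)` the total error is at most `ε t / (t + 1) < ε`, also for `t = 0`.
  obtain ⟨δ, hδ, hδH⟩ := Metric.uniformContinuousOn_iff.1
    (hK.uniformContinuousOn_of_continuous hHc.continuousOn) (ε / (t + 1)) (by positivity)
  have hlim : Tendsto (fun n : ℕ => (t : ℝ) / (n + 1)) atTop (𝓝 0) :=
    tendsto_const_div_atTop_nhds_zero_nat (t : ℝ) |>.comp (tendsto_add_atTop_nat 1) |>.congr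
      fun n => by simp
  obtain ⟨N, hN⟩ := (Metric.tendsto_atTop.1 hlim) δ hδ
  refine ⟨N, fun n hn => ?_⟩
  have hn := hN n hn
  rw [Real.dist_0_eq_abs, abs_of_nonneg (by positivity)] at hn
  rw [Real.dist_0_eq_abs, abs_norm, smul_ouSum_sub_eq hx h]
  have hbound : ∀ k ∈ Finset.range (n + 1), ‖∫ s in (node t n k : ℝ)..(node t n (k + 1)),
        c * (Real.exp (-(c * (t - node t n k))) * x s.toNNReal
          - x (node t n (k + 1)) * Real.exp (-(c * (t - s))))‖ ≤ ε / (t + 1) * (t / (n + 1)) := by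
    intro k hk
    have hk := Finset.mem_range.1 hk
    have h1 : (node t n k : ℝ) ≤ node t n (k + 1) := node_mono t n (Nat.le_succ k)
    have h2 : (node t n (k + 1) : ℝ) ≤ t := node_le (by omega)
    have h0 : (0 : ℝ) ≤ node t n k := NNReal.coe_nonneg _
    refine (intervalIntegral.norm_integral_le_of_norm_le_const
      (C := ε / (t + 1)) fun s hs => ?_).trans_eq ?_
    · rw [Set.uIoc_of_le h1] at hs
      have hd := coe_node_succ_sub t n k
      have hdist := hδH (node t n k, (node t n (k + 1) : ℝ), s)
        ⟨⟨h0, h1.trans h2⟩, ⟨h0.trans h1, h2⟩, h0.trans hs.1.le, hs.2.trans h2⟩ (s, s, s)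
        ⟨⟨h0.trans hs.1.le, hs.2.trans h2⟩, ⟨h0.trans hs.1.le, hs.2.trans h2⟩,
          h0.trans hs.1.le, hs.2.trans h2⟩ (by
          simp only [Prod.dist_eq, Real.dist_eq, sub_self, abs_zero, max_lt_iff]
          refine ⟨?_, ?_, hδ⟩ <;> rw [abs_lt] <;> constructor <;> linarith [hs.1, hs.2])
      have hz : H (s, s, s) = 0 := by simp only [hH]; ring
      rw [hz, dist_zero_right] at hdist
      simpa [hH, Real.toNNReal_coe] using hdist.le
    · rw [coe_node_succ_sub, abs_of_nonneg (by positivity)]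
  refine (norm_sum_le_of_le _ hbound).trans_lt ?_
  rw [Finset.sum_const, Finset.card_range, nsmul_eq_mul]
  push_cast
  have ht : (0 : ℝ) ≤ t := t.2
  rw [show ((n : ℝ) + 1) * (ε / (t + 1) * (t / (n + 1))) = ε * (t / (t + 1)) by field_simp]
  have : (t : ℝ) / (t + 1) < 1 := (div_lt_one (by positivity)).2 (by linarith)
  nlinarith

/-- The path `s ↦ (1 - e^{-cs}) / c` solves the equation driven by `b(s) = s` with `σ = 1`, so the
pathwise theorem evaluates these sums too. With `2c` in place of `c` they are the variances of the
Gaussian Riemann sums. -/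
lemma tendsto_ouSum_coe {c : ℝ} (hc : c ≠ 0) (t : ℝ≥0) :
    Tendsto (fun n => ouSum c t n (fun s => (s : ℝ))) atTop
      (𝓝 ((1 - Real.exp (-(c * t))) / c)) := by
  have h := tendsto_ouSum (c := c) (σ := 1) (x₀ := 0)
    (x := fun s : ℝ≥0 => (1 - Real.exp (-(c * s))) / c) (b := fun s => (s : ℝ))
    (by fun_prop) (fun s => ?_) t
  · simpa using h
  · have hd : ∀ u ∈ Set.uIcc (0 : ℝ) s, HasDerivAt
        (fun u : ℝ => (u - (1 - Real.exp (-(c * u))) / c) / c)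
        ((1 - Real.exp (-(c * u.toNNReal))) / c) u := by
      intro u hu
      rw [Set.uIcc_of_le (NNReal.coe_nonneg s)] at hu
      rw [Real.coe_toNNReal _ hu.1]
      have h1 : HasDerivAt (fun u : ℝ => -(c * u)) (-c) u :=
        ((hasDerivAt_id u).const_mul c).neg.congr_deriv (by ring)
      refine (((hasDerivAt_id u).sub ((h1.exp.const_sub 1).div_const c)).div_const c).congr_deriv ?_
      field_simp
    rw [intervalIntegral.integral_eq_sub_of_hasDerivAt hd
      (Continuous.intervalIntegrable (by fun_prop) _ _)]
    simp only [mul_zero, neg_zero, Real.exp_zero]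
    field_simp
    ring

/-! ### The law of the Wiener integral -/

section Law

variable {Ω : Type*} [MeasurableSpace Ω] {P : Measure Ω} {B : ℝ≥0 → Ω → ℝ}

/-- Increments over the partition are independent and Gaussian. The variance of the weighted sum is
the Riemann sum with rate `2c` of the identity path. -/
lemma integral_exp_ouSum (hB : IsPreBrownianReal B P) (c : ℝ) (t : ℝ≥0) (n : ℕ) (u : ℝ) :
    ∫ ω, Complex.exp (u * ouSum c t n (fun s => B s ω) * Complex.I) ∂P =
      Complex.exp (-(ouSum (2 * c) t n (fun s => (s : ℝ))) * u ^ 2 / 2) := by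
  have hi := hB.hasIndepIncrements (n + 1) (fun i : Fin (n + 2) => node t n i)
    (fun i j hij => node_mono t n hij)
  have hm : ∀ i : Fin (n + 1), AEMeasurable
      (fun ω => B (node t n i.succ) ω - B (node t n i.castSucc) ω) P :=
    fun i => (hB.aemeasurable _).sub (hB.aemeasurable _)
  have h := hi.integral_fun_prod_comp (𝕜 := ℂ) (f := fun (i : Fin (n + 1)) (y : ℝ) => Complex.exp
    (u * (Real.exp (-(c * (t - node t n i))) * y : ℝ) * Complex.I)) hm
    (fun i => Measurable.aestronglyMeasurable (by fun_prop))
  have e1 : ∀ ω, Complex.exp (u * ouSum c t n (fun s => B s ω) * Complex.I) =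
      ∏ i : Fin (n + 1), Complex.exp (u * (Real.exp (-(c * (t - node t n i))) *
        (B (node t n i.succ) ω - B (node t n i.castSucc) ω) : ℝ) * Complex.I) := by
    intro ω
    rw [← Complex.exp_sum, ouSum, Finset.sum_range]
    congr 1
    rw [Complex.ofReal_sum, Finset.mul_sum, Finset.sum_mul]
    rfl
  simp_rw [e1]
  rw [h]
  have e2 : ∀ i : Fin (n + 1), ∫ ω, Complex.exp (u * (Real.exp (-(c * (t - node t n i))) *
        (B (node t n i.succ) ω - B (node t n i.castSucc) ω) : ℝ) * Complex.I) ∂P =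
      Complex.exp (-((Real.exp (-(2 * c * (t - node t n i))) *
        (node t n (i + 1) - node t n i) : ℝ)) * u ^ 2 / 2) := by
    intro i
    have hl := hB.hasLaw_sub (node t n i.succ) (node t n i.castSucc)
    have := hl.integral_comp (f := fun y => Complex.exp (u * (Real.exp (-(c * (t - node t n i))) *
        y : ℝ) * Complex.I)) (Measurable.aestronglyMeasurable (by fun_prop))
    simp only [Function.comp_def, Pi.sub_apply] at this
    rw [this]
    have hc := charFun_gaussianReal (μ := 0)
      (v := nndist (node t n i.succ).1 (node t n i.castSucc).1)
      (t := u * Real.exp (-(c * (t - node t n i))))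
    rw [charFun_apply_real] at hc
    have hnn : ((nndist (node t n i.succ).1 (node t n i.castSucc).1 : ℝ≥0) : ℝ) =
        node t n (i + 1) - node t n i := by
      rw [coe_nndist, Real.dist_eq, abs_of_nonneg]
      · rfl
      · exact sub_nonneg.2 (node_mono t n (by simp))
    have hsq : Real.exp (-(2 * c * (t - node t n i))) = Real.exp (-(c * (t - node t n i))) ^ 2 := by
      rw [← Real.exp_nat_mul]; congr 1; push_cast; ring
    rw [hsq, ← hnn]
    convert hc using 1
    · congr with y
      push_cast
      ring_nf
    · push_cast
      ring_nf
  rw [Finset.prod_congr rfl fun i _ => e2 i, ← Complex.exp_sum, ouSum, Finset.sum_range]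
  congr 1
  simp only [Complex.ofReal_sum]
  rw [← Finset.sum_neg_distrib, Finset.sum_mul, Finset.sum_div]

/-- The characteristic functions of the Riemann sums are explicit, and they converge to that of the
limit by dominated convergence, the integrands having modulus one. -/
theorem map_eq_gaussianReal_of_tendsto_ouSum (hB : IsPreBrownianReal B P) {c : ℝ} (hc : 0 < c)
    (t : ℝ≥0) {S : Ω → ℝ} (hS : AEMeasurable S P)
    (h : ∀ᵐ ω ∂P, Tendsto (fun n => ouSum c t n (fun s => B s ω)) atTop (𝓝 (S ω))) :
    P.map S = gaussianReal 0 ((1 - Real.exp (-(2 * c * t))) / (2 * c)).toNNReal := by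
  have := hB.isGaussianProcess.isProbabilityMeasure
  have := Measure.isProbabilityMeasure_map hS
  apply Measure.ext_of_charFun
  ext u
  have hv : 0 ≤ (1 - Real.exp (-(2 * c * t))) / (2 * c) := by
    have : Real.exp (-(2 * c * t)) ≤ 1 := Real.exp_le_one_iff.2 (by
      have : 0 ≤ 2 * c * t := by positivity
      linarith)
    exact div_nonneg (by linarith) (by positivity)
  rw [charFun_gaussianReal, Real.coe_toNNReal _ hv, charFun_apply_real,
    integral_map hS (Measurable.aestronglyMeasurable (by fun_prop))]
  have h1 : Tendsto (fun n => ∫ ω, Complex.exp (u * ouSum c t n (fun s => B s ω) * Complex.I) ∂P)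
      atTop (𝓝 (∫ ω, Complex.exp (u * S ω * Complex.I) ∂P)) := by
    refine tendsto_integral_of_dominated_convergence (fun _ => 1) (fun n => ?_)
      (integrable_const _) (fun n => ?_) ?_
    · have hm : AEMeasurable (fun ω => ouSum c t n (fun s => B s ω)) P := by
        unfold ouSum
        refine Finset.aemeasurable_fun_sum _ fun k _ => ?_
        exact ((hB.aemeasurable _).sub (hB.aemeasurable _)).const_mul _
      exact AEMeasurable.aestronglyMeasurable (by fun_prop)
    · refine ae_of_all _ fun ω => ?_
      rw [← Complex.ofReal_mul, Complex.norm_exp_ofReal_mul_I]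
    · filter_upwards [h] with ω hω
      have hcont : Continuous fun y : ℝ => Complex.exp (u * y * Complex.I) := by fun_prop
      exact (hcont.tendsto _).comp hω
  have h2 := (Complex.continuous_exp.tendsto _).comp
    ((((Complex.continuous_ofReal.tendsto _).comp (
      tendsto_ouSum_coe (mul_pos two_pos hc).ne' t)).neg.mul_const
      ((u : ℂ) ^ 2)).div_const 2)
  refine tendsto_nhds_unique h1 (Tendsto.congr' (Eventually.of_forall fun n => ?_)
    (h2.trans_eq ?_))
  · exact (integral_exp_ouSum hB c t n u).symm
  · congr 2
    push_cast
    ring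

end Law

/-! ### Solution formula and restarting -/

section Path

variable {c σ x₀ : ℝ} {x b : ℝ≥0 → ℝ}

lemma tendsto_ouSum_div (hσ : σ ≠ 0) (hx : Continuous x)
    (h : ∀ s : ℝ≥0, x s = x₀ - c * (∫ u in (0 : ℝ)..s, x u.toNNReal) + σ * b s) (t : ℝ≥0) :
    Tendsto (fun n => ouSum c t n b) atTop (𝓝 ((x t - Real.exp (-(c * t)) * x 0) / σ)) := by
  refine ((tendsto_ouSum hx h t).div_const σ).congr fun n => ?_
  field_simp

lemma eq_add_ouLim (hσ : σ ≠ 0) (hx : Continuous x)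
    (h : ∀ s : ℝ≥0, x s = x₀ - c * (∫ u in (0 : ℝ)..s, x u.toNNReal) + σ * b s) (t : ℝ≥0) :
    x t = Real.exp (-(c * t)) * x 0 + σ * ouLim c t b := by
  rw [ouLim, (tendsto_ouSum_div hσ hx h t).limsup_eq]
  field_simp
  ring

/-- Restarted at time `t`, the path solves the same equation, driven by the shifted noise. The
Markov structure rests on this. -/
lemma shift_eqn (hx : Continuous x)
    (h : ∀ s : ℝ≥0, x s = x₀ - c * (∫ u in (0 : ℝ)..s, x u.toNNReal) + σ * b s) (t s : ℝ≥0) :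
    x (t + s) = x t - c * (∫ u in (0 : ℝ)..s, x (t + u.toNNReal)) + σ * (b (t + s) - b t) := by
  have hX : Continuous fun u : ℝ => x u.toNNReal := by fun_prop
  have h1 : ∫ u in (0 : ℝ)..s, x (t + u.toNNReal) = ∫ u in (t : ℝ)..(t + s), x u.toNNReal := by
    have := intervalIntegral.integral_comp_add_left (a := 0) (b := s) (fun u => x u.toNNReal) (t : ℝ)
    rw [add_zero] at this
    rw [← this]
    refine intervalIntegral.integral_congr fun u hu => ?_
    rw [Set.uIcc_of_le (NNReal.coe_nonneg s)] at hu
    rw [Real.toNNReal_add (NNReal.coe_nonneg t) hu.1, Real.toNNReal_coe]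
  rw [h1, ← intervalIntegral.integral_interval_sub_left (hX.intervalIntegrable 0 _)
    (hX.intervalIntegrable 0 _)]
  have h2 := h (t + s)
  push_cast at h2
  linear_combination h2 - h t

end Path

/-- A real-valued solution of `dX = -c X dt + σ dB`, `X₀ = x₀`. -/
structure IsOURaw {Ω : Type*} [MeasurableSpace Ω] (c σ x₀ : ℝ) (B X : ℝ≥0 → Ω → ℝ)
    (P : Measure Ω) : Prop where
  brownian : IsPreBrownianReal B P
  measurable : ∀ t, Measurable (X t)
  cont : ∀ᵐ ω ∂P, Continuous fun t => X t ω
  eqn : ∀ᵐ ω ∂P, ∀ t : ℝ≥0,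
    X t ω = x₀ - c * (∫ s in (0 : ℝ)..t, X s.toNNReal ω) + σ * B t ω

/-- The values of the Ornstein-Uhlenbeck process at the times `t` and `t + s`, as a measurable
functional of the driving path. -/
def ouPair (c σ x₀ : ℝ) (t s : ℝ≥0) (w : ℝ≥0 → ℝ) : ℝ × ℝ :=
  (Real.exp (-(c * t)) * x₀ + σ * ouLim c t w,
    Real.exp (-(c * s)) * (Real.exp (-(c * t)) * x₀ + σ * ouLim c t w)
      + σ * ouLim c s (fun u => w (t + u) - w t))

lemma measurable_ouPair (c σ x₀ : ℝ) (t s : ℝ≥0) : Measurable (ouPair c σ x₀ t s) := by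
  have h1 := measurable_ouLim c t
  have h2 : Measurable fun w : ℝ≥0 → ℝ => ouLim c s (fun u => w (t + u) - w t) :=
    (measurable_ouLim c s).comp (by fun_prop)
  unfold ouPair
  fun_prop

namespace IsOURaw

variable {Ω : Type*} [MeasurableSpace Ω] {c σ x₀ : ℝ} {B X : ℝ≥0 → Ω → ℝ} {P : Measure Ω}

lemma ae_eval_zero (h : IsOURaw c σ x₀ B X P) : ∀ᵐ ω ∂P, X 0 ω = x₀ := by
  filter_upwards [h.eqn, h.brownian.eval_zero_ae_eq_zero] with ω h1 h2
  rw [h1 0, h2]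
  simp

lemma ae_eq_add_ouLim (h : IsOURaw c σ x₀ B X P) (hσ : σ ≠ 0) (t : ℝ≥0) :
    ∀ᵐ ω ∂P, X t ω = Real.exp (-(c * t)) * x₀ + σ * ouLim c t (fun u => B u ω) := by
  filter_upwards [h.eqn, h.cont, h.ae_eval_zero] with ω h1 h2 h3
  rw [← h3]
  exact eq_add_ouLim hσ h2 h1 t

lemma ae_shift_eq_add_ouLim (h : IsOURaw c σ x₀ B X P) (hσ : σ ≠ 0) (t s : ℝ≥0) :
    ∀ᵐ ω ∂P, X (t + s) ω =
      Real.exp (-(c * s)) * X t ω + σ * ouLim c s (fun u => B (t + u) ω - B t ω) := by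
  filter_upwards [h.eqn, h.cont] with ω h1 h2
  have h3 := eq_add_ouLim (x := fun s => X (t + s) ω) hσ (by fun_prop) (shift_eqn h2 h1 t) s
  simpa using h3

lemma ae_eq_ouPair (h : IsOURaw c σ x₀ B X P) (hσ : σ ≠ 0) (t s : ℝ≥0) :
    (fun ω => (X t ω, X (t + s) ω)) =ᵐ[P] fun ω => ouPair c σ x₀ t s (fun u => B u ω) := by
  filter_upwards [h.ae_eq_add_ouLim hσ t, h.ae_shift_eq_add_ouLim hσ t s] with ω h1 h2
  rw [h2, h1]
  rfl

lemma ae_tendsto (h : IsOURaw c σ x₀ B X P) (hσ : σ ≠ 0) (t : ℝ≥0) :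
    ∀ᵐ ω ∂P, Tendsto (fun n => ouSum c t n (fun s => B s ω)) atTop
      (𝓝 ((X t ω - Real.exp (-(c * t)) * x₀) / σ)) := by
  filter_upwards [h.eqn, h.cont, h.ae_eval_zero] with ω h1 h2 h3
  rw [← h3]
  exact tendsto_ouSum_div hσ h2 h1 t

lemma ae_shift_tendsto (h : IsOURaw c σ x₀ B X P) (hσ : σ ≠ 0) (t s : ℝ≥0) :
    ∀ᵐ ω ∂P, Tendsto (fun n => ouSum c s n (fun u => B (t + u) ω - B t ω)) atTop
      (𝓝 ((X (t + s) ω - Real.exp (-(c * s)) * X t ω) / σ)) := by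
  filter_upwards [h.eqn, h.cont] with ω h1 h2
  have h3 := tendsto_ouSum_div (x := fun s => X (t + s) ω) hσ (by fun_prop) (shift_eqn h2 h1 t) s
  simpa using h3

/-- The first variable is a functional of the Brownian path up to `t`, the second the same kind of
functional of the path restarted at `t`; these two paths are independent. -/
lemma indepFun_increment (h : IsOURaw c σ x₀ B X P) (hσ : σ ≠ 0) (t s : ℝ≥0) :
    IndepFun (fun ω => X t ω - Real.exp (-(c * t)) * x₀)
      (fun ω => X (t + s) ω - Real.exp (-(c * s)) * X t ω) P := by
  have hi := (h.brownian.indepFun_shift t).symm.comp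
    -- Stopping the path at `t` by `min u t` turns `ouLim` into a function of the path on `Set.Iic
    -- t`.
    (φ := fun w : Set.Iic t → ℝ => σ * ouLim c t (fun u => w ⟨min u t, min_le_right u t⟩))
    (ψ := fun w : ℝ≥0 → ℝ => σ * ouLim c s w)
    (((measurable_ouLim c t).comp (by fun_prop)).const_mul σ)
    ((measurable_ouLim c s).const_mul σ)
  refine hi.congr ?_ ?_
  · filter_upwards [h.ae_eq_add_ouLim hσ t] with ω hω
    rw [hω, Function.comp_apply, add_sub_cancel_left]
    congr 1
    exact ouLim_congr fun u hu => by simp [hu]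
  · filter_upwards [h.ae_shift_eq_add_ouLim hσ t s] with ω hω
    rw [hω, Function.comp_apply, add_sub_cancel_left]

variable {κ γ : ℝ}

lemma two_mul_mul_eq_ouVar (hκ : 0 < κ) (t : ℝ) :
    2 * κ * ((1 - Real.exp (-(2 * (κ * γ) * t))) / (2 * (κ * γ))) = ouVar κ γ t := by
  rw [ouVar, q, show -2 * γ * κ * t = -(2 * (κ * γ) * t) by ring]
  field_simp

lemma map_mul_gaussianReal (hκ : 0 < κ) (hγ : 0 < γ) {S : Ω → ℝ} (hS : AEMeasurable S P) (t : ℝ≥0)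
    (h : P.map S =
      gaussianReal 0 ((1 - Real.exp (-(2 * (κ * γ) * t))) / (2 * (κ * γ))).toNNReal) :
    P.map (fun ω => √(2 * κ) * S ω) = gaussianReal 0 (ouVar κ γ t).toNNReal := by
  have := gaussianReal_const_mul (X := S) ⟨hS, h⟩ √(2 * κ)
  rw [this.map_eq]
  congr 1
  · simp
  · have hv : 0 ≤ (1 - Real.exp (-(2 * (κ * γ) * t))) / (2 * (κ * γ)) := by
      have : Real.exp (-(2 * (κ * γ) * t)) ≤ 1 := Real.exp_le_one_iff.2 (by
        have : 0 ≤ 2 * (κ * γ) * t := by positivity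
        linarith)
      exact div_nonneg (by linarith) (by positivity)
    rw [← two_mul_mul_eq_ouVar hκ, Real.toNNReal_mul (by positivity)]
    congr 1
    ext
    rw [Real.coe_toNNReal _ (by positivity)]
    exact Real.sq_sqrt (by positivity)

lemma map_sub_eq_gaussianReal (hκ : 0 < κ) (hγ : 0 < γ)
    (h : IsOURaw (κ * γ) √(2 * κ) x₀ B X P) (t : ℝ≥0) :
    P.map (fun ω => X t ω - Real.exp (-(κ * γ * t)) * x₀) =
      gaussianReal 0 (ouVar κ γ t).toNNReal := by
  have hσ : √(2 * κ) ≠ 0 := by positivity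
  have hm : AEMeasurable (fun ω => (X t ω - Real.exp (-(κ * γ * t)) * x₀) / √(2 * κ)) P :=
    (((h.measurable t).sub_const _).div_const _).aemeasurable
  rw [← map_mul_gaussianReal hκ hγ hm t (map_eq_gaussianReal_of_tendsto_ouSum h.brownian
    (by positivity) t hm (h.ae_tendsto hσ t))]
  congr with ω
  field_simp

lemma map_increment_eq_gaussianReal (hκ : 0 < κ) (hγ : 0 < γ)
    (h : IsOURaw (κ * γ) √(2 * κ) x₀ B X P) (t s : ℝ≥0) :
    P.map (fun ω => X (t + s) ω - Real.exp (-(κ * γ * s)) * X t ω) =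
      gaussianReal 0 (ouVar κ γ s).toNNReal := by
  have hσ : √(2 * κ) ≠ 0 := by positivity
  have hm : AEMeasurable
      (fun ω => (X (t + s) ω - Real.exp (-(κ * γ * s)) * X t ω) / √(2 * κ)) P :=
    (((h.measurable _).sub ((h.measurable t).const_mul _)).div_const _).aemeasurable
  rw [← map_mul_gaussianReal hκ hγ hm s (map_eq_gaussianReal_of_tendsto_ouSum
    (h.brownian.shift t) (by positivity) s hm (h.ae_shift_tendsto hσ t s))]
  congr with ω
  field_simp

/-- These are the coordinates in which the joint law at two times is a product, so that later
integrals can be done one variable at a time. -/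
theorem map_pair_eq_prod (hκ : 0 < κ) (hγ : 0 < γ)
    (h : IsOURaw (κ * γ) √(2 * κ) x₀ B X P) (t s : ℝ≥0) :
    P.map (fun ω => (X t ω - Real.exp (-(κ * γ * t)) * x₀,
      X (t + s) ω - Real.exp (-(κ * γ * s)) * X t ω)) =
      (gaussianReal 0 (ouVar κ γ t).toNNReal).prod (gaussianReal 0 (ouVar κ γ s).toNNReal) := by
  have := (IsPreBrownianReal.isGaussianProcess h.brownian).isProbabilityMeasure
  have hσ : √(2 * κ) ≠ 0 := by positivity
  rw [(indepFun_iff_map_prod_eq_prod_map_map ?_ ?_).1 (h.indepFun_increment hσ t s),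
    h.map_sub_eq_gaussianReal hκ hγ, h.map_increment_eq_gaussianReal hκ hγ]
  · exact ((h.measurable t).sub_const _).aemeasurable
  · exact ((h.measurable _).sub ((h.measurable t).const_mul _)).aemeasurable

theorem map_eq_gaussianReal (hκ : 0 < κ) (hγ : 0 < γ)
    (h : IsOURaw (κ * γ) √(2 * κ) x₀ B X P) (t : ℝ≥0) :
    P.map (X t) =
      gaussianReal (Real.exp (-(κ * γ * t)) * x₀) (ouVar κ γ t).toNNReal := by
  have hm := (h.measurable t).sub_const (Real.exp (-(κ * γ * t)) * x₀)
  have := gaussianReal_add_const (X := fun ω => X t ω - Real.exp (-(κ * γ * t)) * x₀)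
    ⟨hm.aemeasurable, h.map_sub_eq_gaussianReal hκ hγ t⟩ (Real.exp (-(κ * γ * t)) * x₀)
  simpa using this.map_eq

end IsOURaw

/-! ### Rotated Brownian motions -/

section Rotation

variable {d : ℕ} {Ω : Type*} [MeasurableSpace Ω] {P : Measure Ω}
  {W Y : ℝ≥0 → Ω → EuclideanSpace ℝ (Fin d)}

/-- Independent Gaussian families are jointly Gaussian. A finite set of pairs is enlarged to all
coordinates at the times occurring in it, and its vector is recovered by a linear projection. -/
lemma IsBrownian.isGaussianProcess [IsProbabilityMeasure P] (hW : IsBrownian W P) :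
    IsGaussianProcess (fun (p : Fin d × ℝ≥0) ω => W p.2 ω p.1) P := by
  classical
  refine ⟨fun I => ?_⟩
  let J : Finset ℝ≥0 := I.image Prod.snd
  have h1 : iIndepFun (fun (i : Fin d) ω (t : J) => W t ω i) P :=
    hW.indep.comp (fun _ w (t : J) => w t) (fun _ => by fun_prop)
  have h2 := h1.hasGaussianLaw fun i =>
    (IsPreBrownianReal.isGaussianProcess (hW.coord i).toIsPreBrownianReal).hasGaussianLaw J
  let L : (Fin d → J → ℝ) →L[ℝ] (I → ℝ) :=
    ContinuousLinearMap.pi fun p : I =>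
      (ContinuousLinearMap.proj (R := ℝ) (φ := fun _ : J => ℝ)
        ⟨p.1.2, Finset.mem_image_of_mem _ p.2⟩).comp
        (ContinuousLinearMap.proj (R := ℝ) (φ := fun _ : Fin d => J → ℝ) p.1.1)
  exact h2.map L

lemma inner_eq_sum (v x : EuclideanSpace ℝ (Fin d)) : inner ℝ v x = ∑ i, v i * x i := by
  rw [PiLp.inner_apply]
  exact Finset.sum_congr rfl fun i _ => by simp [mul_comm]

lemma IsBrownian.isGaussianProcess_inner [IsProbabilityMeasure P] (hW : IsBrownian W P)
    {ι : Type*} (v : ι → EuclideanSpace ℝ (Fin d)) (τ : ι → ℝ≥0) :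
    IsGaussianProcess (fun (p : ι) ω => inner ℝ (v p) (W (τ p) ω)) P := by
  classical
  refine hW.isGaussianProcess.of_isGaussianProcess fun p => ?_
  refine ⟨Finset.univ.image fun i : Fin d => (i, τ p),
    ∑ i : Fin d, (v p i) • ContinuousLinearMap.proj
      (⟨(i, τ p), Finset.mem_image_of_mem _ (Finset.mem_univ i)⟩ :
        (Finset.univ.image fun i : Fin d => (i, τ p))), fun ω => ?_⟩
  simp [inner_eq_sum]

/-- Cross terms vanish by independence of the coordinates. The formula serves twice: for a unit
vector it identifies a Brownian motion, for orthogonal vectors it is zero. -/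
lemma IsBrownian.covariance_inner [IsProbabilityMeasure P] (hW : IsBrownian W P)
    (v w : EuclideanSpace ℝ (Fin d)) (s t : ℝ≥0) :
    cov[fun ω => inner ℝ v (W s ω), fun ω => inner ℝ w (W t ω); P] = inner ℝ v w * min s t := by
  have hL : ∀ i t, MemLp (fun ω => W t ω i) 2 P := fun i t =>
    ((IsPreBrownianReal.isGaussianProcess (hW.coord i).toIsPreBrownianReal).hasGaussianLaw_eval
      t).memLp_two
  simp only [inner_eq_sum]
  rw [covariance_fun_sum_fun_sum (fun i => (hL i s).const_mul _) (fun i => (hL i t).const_mul _),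
    Finset.sum_mul]
  refine Finset.sum_congr rfl fun i _ => ?_
  rw [Finset.sum_eq_single i]
  · rw [covariance_const_mul_left, covariance_const_mul_right, (hW.coord i).covariance_fun_eval]
    push_cast
    ring
  · intro j _ hij
    rw [covariance_const_mul_left, covariance_const_mul_right]
    have : IndepFun (fun ω => W s ω i) (fun ω => W t ω j) P :=
      (hW.indep.indepFun hij.symm).comp (measurable_pi_apply s) (measurable_pi_apply t)
    rw [this.covariance_eq_zero (hL i s) (hL j t)]
    simp
  · simp

lemma IsBrownian.isPreBrownianReal_inner [IsProbabilityMeasure P] (hW : IsBrownian W P)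
    {v : EuclideanSpace ℝ (Fin d)} (hv : ‖v‖ = 1) :
    IsPreBrownianReal (fun t ω => inner ℝ v (W t ω)) P := by
  refine (hW.isGaussianProcess_inner (fun _ : ℝ≥0 => v) id).isPreBrownianReal_of_covariance
    (fun t => ?_) (fun s t hst => ?_)
  · simp only [inner_eq_sum, id]
    rw [integral_finsetSum _ fun i _ => ((hW.coord i).integrable_eval t).const_mul _]
    refine Finset.sum_eq_zero fun i _ => ?_
    rw [integral_const_mul, (hW.coord i).integral_eval, mul_zero]
  · simp only [id]
    rw [hW.covariance_inner, real_inner_self_eq_norm_sq, hv, min_eq_left hst]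
    simp

lemma IsBrownian.isBrownianReal_inner [IsProbabilityMeasure P] (hW : IsBrownian W P)
    {v : EuclideanSpace ℝ (Fin d)} (hv : ‖v‖ = 1) :
    IsBrownianReal (fun t ω => inner ℝ v (W t ω)) P where
  toIsPreBrownianReal := hW.isPreBrownianReal_inner hv
  cont := by
    have h : ∀ᵐ ω ∂P, ∀ i, Continuous fun t => W t ω i := ae_all_iff.2 fun i => (hW.coord i).cont
    filter_upwards [h] with ω hω
    simp only [inner_eq_sum]
    exact continuous_finsetSum _ fun i _ => continuous_const.mul (hω i)

/-- For jointly Gaussian families, vanishing cross-covariances imply independence of whole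
processes. -/
lemma IsBrownian.iIndepFun_inner [IsProbabilityMeasure P] (hW : IsBrownian W P)
    (e : OrthonormalBasis (Fin d) ℝ (EuclideanSpace ℝ (Fin d))) :
    iIndepFun (fun r ω (t : ℝ≥0) => inner ℝ (e r) (W t ω)) P := by
  have hG : IsGaussianProcess (fun (p : (_ : Fin d) × ℝ≥0) ω => inner ℝ (e p.1) (W p.2 ω)) P :=
    hW.isGaussianProcess_inner (fun p : (_ : Fin d) × ℝ≥0 => e p.1) (fun p => p.2)
  refine IsGaussianProcess.iIndepFun_of_covariance_eq_zero (S := fun _ : Fin d => ℝ≥0)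
    (X := fun (r : Fin d) (t : ℝ≥0) ω => inner ℝ (e r) (W t ω)) hG (fun r t => ?_)
    (fun r s hrs t u => ?_)
  · exact (Measurable.const_inner (hW.measurable t)).aemeasurable
  · exact (hW.covariance_inner (e r) (e s) t u).trans (by rw [e.orthonormal.2 hrs, zero_mul])

/-- The coordinates of an Ornstein-Uhlenbeck process along an eigenvector. -/
lemma IsOrnsteinUhlenbeck.inner_eigenvector [IsProbabilityMeasure P] {κ : ℝ}
    {Γ : Matrix (Fin d) (Fin d) ℝ} {y₀ : EuclideanSpace ℝ (Fin d)}
    (hY : IsOrnsteinUhlenbeck κ Γ y₀ W Y P) (hΓ : Γᵀ = Γ) {v : EuclideanSpace ℝ (Fin d)}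
    (hv : ‖v‖ = 1) {γ : ℝ} (hvγ : Matrix.toEuclideanLin Γ v = γ • v) :
    IsOURaw (κ * γ) √(2 * κ) (inner ℝ v y₀) (fun t ω => inner ℝ v (W t ω))
      (fun t ω => inner ℝ v (Y t ω)) P where
  brownian := hY.brownian.isPreBrownianReal_inner hv
  measurable t := Measurable.const_inner (hY.measurable t)
  cont := by
    filter_upwards [hY.cont] with ω h
    fun_prop
  eqn := by
    filter_upwards [hY.cont, hY.eqn] with ω h1 h2 t
    -- Symmetry of `Γ` moves it onto the eigenvector, which decouples the scalar equation.
    have hL : ∀ x, inner ℝ v (Matrix.toEuclideanLin Γ x) = γ * inner ℝ v x := by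
      intro x
      have hs : (Matrix.toEuclideanLin Γ).IsSymmetric :=
        Matrix.isSymmetric_toEuclideanLin_iff.2 (by
          rwa [Matrix.IsHermitian, Matrix.conjTranspose_eq_transpose_of_trivial])
      rw [← hs v x, hvγ, real_inner_smul_left]
    have hc : Continuous fun s : ℝ => Matrix.toEuclideanLin Γ (Y s.toNNReal ω) :=
      (LinearMap.continuous_of_finiteDimensional _).comp (h1.comp continuous_real_toNNReal)
    rw [h2 t, inner_add_right, inner_sub_right, real_inner_smul_right, real_inner_smul_right]
    have := ((innerSL ℝ v).intervalIntegral_comp_comm (hc.intervalIntegrable (μ := volume) 0 t))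
    simp only [innerSL_apply_apply, hL, intervalIntegral.integral_const_mul] at this
    rw [← this]
    ring

end Rotation

/-! ### The law of the one-dimensional entropy production -/

/-- After completing the square, the preimage lies in the images of a null set under the two inverse
branches `v₀ ± √·`, together with the vertex. Differentiable maps send null sets to null sets. -/
lemma volume_quadratic_preimage_eq_zero {a : ℝ} (ha : a ≠ 0) (b c : ℝ) {s : Set ℝ}
    (hs : volume s = 0) : volume {v : ℝ | a * v ^ 2 + b * v + c ∈ s} = 0 := by
  set v₀ := -b / (2 * a)
  set c' := c - b ^ 2 / (4 * a)
  have hsq : ∀ v, (a * v ^ 2 + b * v + c - c') / a = (v - v₀) ^ 2 := by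
    intro v
    simp only [v₀, c']
    field_simp
    ring
  -- The vertex value is excluded, because the square root is not differentiable there.
  set T := s ∩ {w | 0 < (w - c') / a}
  have hT : volume T = 0 := measure_mono_null Set.inter_subset_left hs
  have himg : ∀ ε : ℝ, volume ((fun w => v₀ + ε * √((w - c') / a)) '' T) = 0 := by
    intro ε
    refine addHaar_image_eq_zero_of_differentiableOn_of_addHaar_eq_zero volume ?_ hT
    intro w hw
    refine DifferentiableAt.differentiableWithinAt ?_
    exact ((DifferentiableAt.sqrt (by fun_prop) hw.2.ne').const_mul ε).const_add v₀
  refine measure_mono_null (t := (fun w => v₀ + 1 * √((w - c') / a)) '' T ∪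
    (fun w => v₀ + (-1) * √((w - c') / a)) '' T ∪ {v₀}) ?_ ?_
  · intro v hv
    by_cases h0 : v = v₀
    · exact Or.inr h0
    have hp : 0 < (v - v₀) ^ 2 := by
      have := sub_ne_zero.2 h0
      positivity
    have hmem : a * v ^ 2 + b * v + c ∈ T := ⟨hv, by
      change 0 < (a * v ^ 2 + b * v + c - c') / a
      rwa [hsq]⟩
    refine Or.inl ?_
    rcases le_total v₀ v with h | h
    · refine Or.inl ⟨_, hmem, ?_⟩
      simp only [hsq]
      rw [Real.sqrt_sq (sub_nonneg.2 h)]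
      ring
    · refine Or.inr ⟨_, hmem, ?_⟩
      simp only [hsq]
      rw [← neg_sub v₀ v, neg_sq, Real.sqrt_sq (sub_nonneg.2 h)]
      ring
  · rw [measure_union_null_iff, measure_union_null_iff]
    exact ⟨⟨himg 1, himg (-1)⟩, by simp⟩

/-- Every section in the second variable is null by the previous lemma, so no regularity of `μ`
enters. -/
lemma map_quadratic_absolutelyContinuous {μ ν : Measure ℝ} [SFinite μ] [SFinite ν]
    (hν : ν ≪ volume) {a : ℝ} (ha : a ≠ 0) {b c : ℝ → ℝ} (hb : Measurable b) (hc : Measurable c) :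
    (μ.prod ν).map (fun p => a * p.2 ^ 2 + b p.1 * p.2 + c p.1) ≪ volume := by
  refine Measure.AbsolutelyContinuous.mk fun s hs h => ?_
  have hm : Measurable fun p : ℝ × ℝ => a * p.2 ^ 2 + b p.1 * p.2 + c p.1 := by fun_prop
  rw [Measure.map_apply hm hs, Measure.prod_apply (hm hs), lintegral_eq_zero_iff]
  · exact ae_of_all _ fun ξ => hν (volume_quadratic_preimage_eq_zero ha (b ξ) (c ξ) h)
  · exact measurable_measure_prodMk_left (hm hs)

/-- Completing the square turns the integrand into a constant times the normal density with mean `b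
s / w` and variance `s / w`, where `w = 1 - 2as`. -/
lemma lintegral_exp_quadratic_gaussianReal {s : ℝ} (hs : 0 < s) {a : ℝ} (ha : 0 < 1 - 2 * a * s)
    (b c : ℝ) :
    ∫⁻ v, ENNReal.ofReal (Real.exp (a * v ^ 2 + b * v + c)) ∂(gaussianReal 0 s.toNNReal) =
      ENNReal.ofReal ((1 - 2 * a * s) ^ (-(1 / 2) : ℝ)
        * Real.exp (c + b ^ 2 * s / (2 * (1 - 2 * a * s)))) := by
  set w := 1 - 2 * a * s with hw
  have hsn : s.toNNReal ≠ 0 := by simpa using hs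
  have hs' : 0 < s / w := div_pos hs ha
  have hs'n : (s / w).toNNReal ≠ 0 := by simpa using hs'
  rw [gaussianReal_of_var_ne_zero _ hsn, lintegral_withDensity_eq_lintegral_mul _
    (measurable_gaussianPDF _ _) (by fun_prop)]
  have hK : 0 ≤ w ^ (-(1 / 2) : ℝ) * Real.exp (c + b ^ 2 * s / (2 * w)) := by positivity
  rw [← mul_one (ENNReal.ofReal _), ← lintegral_gaussianPDF_eq_one (b * (s / w)) hs'n,
    ← lintegral_const_mul _ (measurable_gaussianPDF _ _)]
  refine lintegral_congr fun v => ?_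
  rw [Pi.mul_apply, gaussianPDF, gaussianPDF, ← ENNReal.ofReal_mul (gaussianPDFReal_nonneg _ _ _),
    ← ENNReal.ofReal_mul hK]
  congr 1
  rw [gaussianPDFReal, gaussianPDFReal, Real.coe_toNNReal _ hs.le, Real.coe_toNNReal _ hs'.le,
    mul_assoc, ← Real.exp_add]
  have h1 : (√(2 * Real.pi * s))⁻¹ = w ^ (-(1 / 2) : ℝ) * (√(2 * Real.pi * (s / w)))⁻¹ := by
    rw [Real.rpow_neg ha.le, ← Real.sqrt_eq_rpow, ← mul_inv, ← Real.sqrt_mul ha.le]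
    congr 2
    field_simp
  rw [h1, show ∀ p q r t : ℝ, p * q * (r * t) = p * r * (q * t) from fun p q r t => by ring,
    ← Real.exp_add]
  congr 2
  have hsub : a = (1 - w) / (2 * s) := by
    rw [hw]
    field_simp
    ring
  rw [hsub]
  field_simp
  ring

/-- Computing with lower integrals yields integrability and the value together. -/
lemma integrable_and_integral_eq_of_lintegral {α : Type*} [MeasurableSpace α] {μ : Measure α}
    {f : α → ℝ} (hf : Measurable f) (h0 : ∀ x, 0 ≤ f x) {c : ℝ} (hc : 0 ≤ c)
    (h : ∫⁻ x, ENNReal.ofReal (f x) ∂μ = ENNReal.ofReal c) :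
    Integrable f μ ∧ ∫ x, f x ∂μ = c := by
  constructor
  · refine ⟨hf.aestronglyMeasurable, ?_⟩
    rw [hasFiniteIntegral_iff_ofReal (ae_of_all _ h0), h]
    exact ENNReal.ofReal_lt_top
  · rw [integral_eq_lintegral_of_nonneg_ae (ae_of_all _ h0) hf.aestronglyMeasurable, h,
      ENNReal.toReal_ofReal hc]

/-- The entropy production as a function of the centred value at time `t₁` and of the
increment. -/
def entropyFun (κ γ x t₁ t₂ : ℝ) (p : ℝ × ℝ) : ℝ :=
  entropy1 κ γ x t₁ t₂ (Real.exp (-(κ * γ * t₁)) * x + p.1)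
    (Real.exp (-(κ * γ * (t₂ - t₁))) * (Real.exp (-(κ * γ * t₁)) * x + p.1) + p.2)

lemma measurable_entropyFun (κ γ x t₁ t₂ : ℝ) : Measurable (entropyFun κ γ x t₁ t₂) := by
  unfold entropyFun entropy1
  fun_prop

/-- The law of the one-dimensional entropy production. -/
def entropyLaw (κ γ x t₁ t₂ : ℝ) : Measure ℝ :=
  ((gaussianReal 0 (ouVar κ γ t₁).toNNReal).prod
    (gaussianReal 0 (ouVar κ γ (t₂ - t₁)).toNNReal)).map (entropyFun κ γ x t₁ t₂)

lemma exp_mul_exp_sub (κ γ t₁ t₂ : ℝ) : Real.exp (-(κ * γ * t₂)) =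
    Real.exp (-(κ * γ * t₁)) * Real.exp (-(κ * γ * (t₂ - t₁))) := by
  rw [← Real.exp_add]
  congr 1
  ring

/-- Quadratic in `v` with leading coefficient free of `ξ`: the form needed both for absolute
continuity and for the inner Gaussian integral. -/
lemma entropyFun_eq (κ γ x t₁ t₂ ξ v : ℝ) :
    entropyFun κ γ x t₁ t₂ (ξ, v) =
      (γ / (2 * (1 - q κ γ t₂)) - γ / 2) * v ^ 2
      + γ * Real.exp (-(κ * γ * (t₂ - t₁))) * (ξ / (1 - q κ γ t₂)
          - (Real.exp (-(κ * γ * t₁)) * x + ξ)) * v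
      + (1 / 2 * Real.log ((1 - q κ γ t₂) / (1 - q κ γ t₁)) - γ * ξ ^ 2 / (2 * (1 - q κ γ t₁))
        + γ * (Real.exp (-(κ * γ * (t₂ - t₁))) * ξ) ^ 2 / (2 * (1 - q κ γ t₂))
        + γ / 2 * (1 - Real.exp (-(κ * γ * (t₂ - t₁))) ^ 2)
          * (Real.exp (-(κ * γ * t₁)) * x + ξ) ^ 2) := by
  unfold entropyFun entropy1
  rw [exp_mul_exp_sub κ γ t₁ t₂]
  simp only [div_eq_mul_inv, mul_inv]
  ring

theorem entropyLaw_absolutelyContinuous {κ γ t₁ t₂ : ℝ} (hκ : 0 < κ) (hγ : 0 < γ) (ht₁ : 0 < t₁)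
    (ht : t₁ < t₂) (x : ℝ) : entropyLaw κ γ x t₁ t₂ ≪ volume := by
  have h2 := sub_pos.2 (q_lt_one hκ hγ (ht₁.trans ht))
  have ha : γ / (2 * (1 - q κ γ t₂)) - γ / 2 ≠ 0 := by
    have : γ / (2 * (1 - q κ γ t₂)) - γ / 2 = γ * q κ γ t₂ / (2 * (1 - q κ γ t₂)) := by
      field_simp
      ring
    rw [this]
    have := q_pos κ γ t₂
    positivity
  have hν : gaussianReal 0 (ouVar κ γ (t₂ - t₁)).toNNReal ≪ volume :=
    gaussianReal_absolutelyContinuous 0 (by simpa using ouVar_pos hκ hγ (sub_pos.2 ht))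
  unfold entropyLaw
  have he : entropyFun κ γ x t₁ t₂ = fun p : ℝ × ℝ => _ :=
    funext fun p : ℝ × ℝ => entropyFun_eq κ γ x t₁ t₂ p.1 p.2
  rw [he]
  exact map_quadratic_absolutelyContinuous hν ha (b := fun ξ =>
    γ * Real.exp (-(κ * γ * (t₂ - t₁))) * (ξ / (1 - q κ γ t₂)
          - (Real.exp (-(κ * γ * t₁)) * x + ξ)))
        (c := fun ξ => 1 / 2 * Real.log ((1 - q κ γ t₂) / (1 - q κ γ t₁)) - γ * ξ ^ 2 / (2 * (1 - q κ γ t₁))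
        + γ * (Real.exp (-(κ * γ * (t₂ - t₁))) * ξ) ^ 2 / (2 * (1 - q κ γ t₂))
        + γ / 2 * (1 - Real.exp (-(κ * γ * (t₂ - t₁))) ^ 2)
          * (Real.exp (-(κ * γ * t₁)) * x + ξ) ^ 2) (by fun_prop) (by fun_prop)

/-- The value of the discriminant left by the integration over the increment is positive. -/
lemma one_sub_mul_pos {q₁ q₂ l : ℝ} (h2 : 0 < q₂) (h21 : q₂ < q₁) (h1 : q₁ < 1)
    (hD : 0 < 1 + (q₁ - q₂) * l - q₂ * (q₁ - q₂) / (1 - q₂) * l ^ 2) :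
    0 < 1 - l * (q₁ - q₂) * q₂ / (q₁ * (1 - q₂)) := by
  by_contra! hcon
  have hq1 : 0 < q₁ := h2.trans h21
  have hq2 : 0 < 1 - q₂ := by linarith
  have hd : 0 < q₁ - q₂ := by linarith
  rw [sub_nonpos, one_le_div (by positivity)] at hcon
  have hl : 0 < l := by
    by_contra! hl
    have : l * (q₁ - q₂) * q₂ ≤ 0 :=
      mul_nonpos_of_nonpos_of_nonneg (mul_nonpos_of_nonpos_of_nonneg hl hd.le) h2.le
    have : 0 < q₁ * (1 - q₂) := by positivity
    linarith
  have hD' : 0 < (1 - q₂) + (q₁ - q₂) * l * (1 - q₂) - q₂ * (q₁ - q₂) * l ^ 2 := by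
    have := mul_pos hD hq2
    field_simp at this
    linarith
  -- With this bound on its quadratic term, `(1 - q₂) D > 0` gives `(1 - q₂)(1 - q₂ l) > 0`. Then
  -- `q₂ l < 1`, and `hcon` would force `q₁ > 1`.
  have h3 : q₁ * (1 - q₂) * l ≤ l * (q₁ - q₂) * q₂ * l := mul_le_mul_of_nonneg_right hcon hl.le
  have h4 : 0 < (1 - q₂) + (q₁ - q₂) * l * (1 - q₂) - q₁ * (1 - q₂) * l := by nlinarith
  have h5 : 0 < (1 - q₂) * (1 - q₂ * l) := by nlinarith
  have h6 : q₂ * l < 1 := by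
    have := pos_of_mul_pos_right h5 hq2.le
    linarith
  have h7 : q₁ * (1 - q₂) < q₁ - q₂ := by nlinarith
  nlinarith

/-- Here `q₁ = α²`, `q₂ = α²β²`, `N / R` is the discriminant of the integral over `v`, and `M / R =
D(l)`. The discriminant of the remaining integral over `ξ` is their quotient, so the two together
leave `D(l)`. -/
lemma entropy_exponent_quadratic_coeff {α β l γ R N M u : ℝ} (hγ : γ ≠ 0)
    (hR0 : R ≠ 0) (hN0 : N ≠ 0) (hu0 : u ≠ 0) (hu : u = 1 - α ^ 2) (hR : R = 1 - α ^ 2 * β ^ 2)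
    (hN : N = R - l * (1 - β ^ 2) * (α ^ 2 * β ^ 2))
    (hM : M = R + (α ^ 2 - α ^ 2 * β ^ 2) * l * R
      - α ^ 2 * β ^ 2 * (α ^ 2 - α ^ 2 * β ^ 2) * l ^ 2) :
    1 - 2 * (l * (-γ / (2 * u) + γ * β ^ 2 / (2 * R) + γ / 2 * (1 - β ^ 2))
      + l ^ 2 * γ * β ^ 2 * (α ^ 2 * β ^ 2 / R) ^ 2 * (1 - β ^ 2) / (2 * (N / R))) * (u / γ) =
      (M / R) / (N / R) := by
  field_simp
  subst hM
  subst hN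
  subst hR
  subst hu
  ring

/-- The constants left by both completions of the square add up to the exponent in `mgf1`. -/
lemma entropy_exponent_const {α β l γ x R N M u : ℝ} (hγ : γ ≠ 0)
    (hR0 : R ≠ 0) (hN0 : N ≠ 0) (hM0 : M ≠ 0) (hu : u = 1 - α ^ 2) (hR : R = 1 - α ^ 2 * β ^ 2)
    (hN : N = R - l * (1 - β ^ 2) * (α ^ 2 * β ^ 2))
    (hM : M = R + (α ^ 2 - α ^ 2 * β ^ 2) * l * R
      - α ^ 2 * β ^ 2 * (α ^ 2 - α ^ 2 * β ^ 2) * l ^ 2) :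
    l * (γ / 2 * (1 - β ^ 2) * α ^ 2 * x ^ 2)
      + l ^ 2 * γ * β ^ 2 * α ^ 2 * x ^ 2 * (1 - β ^ 2) / (2 * (N / R))
      + (l * γ * (1 - β ^ 2) * α * x
        - l ^ 2 * γ * β ^ 2 * α * x * (α ^ 2 * β ^ 2 / R) * (1 - β ^ 2) / (N / R)) ^ 2 * (u / γ)
        / (2 * (M / R / (N / R))) =
      (α ^ 2 - α ^ 2 * β ^ 2) * l * (l + 1) * (γ * x ^ 2 / 2) / (M / R) := by
  field_simp
  subst hM
  subst hN
  subst hR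
  subst hu
  ring

/-- By Tonelli, a Gaussian integral over `v` is followed by one over `ξ`. Positivity of `D` suffices
for both, by `one_sub_mul_pos`. -/
theorem lintegral_exp_entropyFun {κ γ t₁ t₂ : ℝ} (hκ : 0 < κ) (hγ : 0 < γ) (ht₁ : 0 < t₁)
    (ht : t₁ < t₂) (x : ℝ) {l : ℝ} (hD : 0 < quadD κ γ t₁ t₂ l) :
    ∫⁻ p, ENNReal.ofReal (Real.exp (l * entropyFun κ γ x t₁ t₂ p))
      ∂((gaussianReal 0 (ouVar κ γ t₁).toNNReal).prod
        (gaussianReal 0 (ouVar κ γ (t₂ - t₁)).toNNReal)) =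
      ENNReal.ofReal (mgf1 κ γ x t₁ t₂ l) := by
  have hs1 := ouVar_pos hκ hγ ht₁
  have hs := ouVar_pos hκ hγ (sub_pos.2 ht)
  have hq1 := sub_pos.2 (q_lt_one hκ hγ ht₁)
  have hq2 := sub_pos.2 (q_lt_one hκ hγ (ht₁.trans ht))
  have hw := one_sub_mul_pos (q_pos κ γ t₂) (q_lt_q hκ hγ ht) (q_lt_one hκ hγ ht₁) hD
  have hQ2 : q κ γ t₂ =
      Real.exp (-(κ * γ * t₁)) ^ 2 * Real.exp (-(κ * γ * (t₂ - t₁))) ^ 2 := by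
    rw [q_eq_sq, exp_mul_exp_sub κ γ t₁ t₂, mul_pow]
  have hQ1 := q_eq_sq κ γ t₁
  have hQ := q_eq_sq κ γ (t₂ - t₁)
  have hα := Real.exp_pos (-(κ * γ * t₁))
  have hβ := Real.exp_pos (-(κ * γ * (t₂ - t₁)))
  unfold quadD at hD
  have hS1 : ouVar κ γ t₁ = (1 - q κ γ t₁) / γ := rfl
  have hS : ouVar κ γ (t₂ - t₁) = (1 - q κ γ (t₂ - t₁)) / γ := rfl
  unfold mgf1 quadD
  rw [lintegral_prod _ (by
    have := measurable_entropyFun κ γ x t₁ t₂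
    fun_prop)]
  simp only [entropyFun_eq]
  set K := Real.log ((1 - q κ γ t₂) / (1 - q κ γ t₁)) with hK
  have hratio : ((1 - q κ γ t₂) / (1 - q κ γ t₁)) ^ (l / 2) = Real.exp (l * (1 / 2 * K)) := by
    rw [Real.rpow_def_of_pos (div_pos hq2 hq1)]
    congr 1
    ring
  rw [hratio]
  clear_value K
  clear hK hratio
  rw [hQ] at hS
  rw [hQ1] at hS1 hw hD hq1
  rw [hQ1]
  set α := Real.exp (-(κ * γ * t₁))
  set β := Real.exp (-(κ * γ * (t₂ - t₁)))
  set s₁ := ouVar κ γ t₁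
  set s := ouVar κ γ (t₂ - t₁)
  set q₂ := q κ γ t₂
  clear_value α β s₁ s q₂
  subst hQ2
  set R := 1 - α ^ 2 * β ^ 2 with hR
  set N := R - l * (1 - β ^ 2) * (α ^ 2 * β ^ 2) with hN
  set M := R + (α ^ 2 - α ^ 2 * β ^ 2) * l * R
    - α ^ 2 * β ^ 2 * (α ^ 2 - α ^ 2 * β ^ 2) * l ^ 2 with hM
  have hww : 1 - l * (α ^ 2 - α ^ 2 * β ^ 2) * (α ^ 2 * β ^ 2) / (α ^ 2 * R) = N / R := by
    rw [hN]
    field_simp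
  have hDM : 1 + (α ^ 2 - α ^ 2 * β ^ 2) * l
      - α ^ 2 * β ^ 2 * (α ^ 2 - α ^ 2 * β ^ 2) / R * l ^ 2 = M / R := by
    rw [hM]
    field_simp
  rw [hww] at hw
  rw [hDM] at hD
  rw [hDM]
  have hN0 : N ≠ 0 := fun h => by simp [h] at hw
  have hM0 : M ≠ 0 := fun h => by simp [h] at hD
  have hwR : N / R * R = N := div_mul_cancel₀ _ hq2.ne'
  -- `p`, `r`, `C` are the coefficients of the exponent in `ξ` that the integration over `v` leaves.
  set p := l * (-γ / (2 * (1 - α ^ 2)) + γ * β ^ 2 / (2 * R) + γ / 2 * (1 - β ^ 2))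
    + l ^ 2 * γ * β ^ 2 * ((α ^ 2 * β ^ 2) / R) ^ 2 * (1 - β ^ 2) / (2 * (N / R)) with hp
  set r := l * γ * (1 - β ^ 2) * α * x
    - l ^ 2 * γ * β ^ 2 * α * x * ((α ^ 2 * β ^ 2) / R) * (1 - β ^ 2) / (N / R) with hr
  set C := l * (1 / 2 * K + γ / 2 * (1 - β ^ 2) * α ^ 2 * x ^ 2)
    + l ^ 2 * γ * β ^ 2 * α ^ 2 * x ^ 2 * (1 - β ^ 2) / (2 * (N / R)) with hC
  have hinner : ∀ ξ : ℝ, ∫⁻ v, ENNReal.ofReal (Real.exp (l * ((γ / (2 * R) - γ / 2) * v ^ 2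
      + γ * β * (ξ / R - (α * x + ξ)) * v
      + (1 / 2 * K - γ * ξ ^ 2 / (2 * (1 - α ^ 2)) + γ * (β * ξ) ^ 2 / (2 * R)
        + γ / 2 * (1 - β ^ 2) * (α * x + ξ) ^ 2)))) ∂(gaussianReal 0 s.toNNReal) =
      ENNReal.ofReal ((N / R) ^ (-(1 / 2) : ℝ)) *
        ENNReal.ofReal (Real.exp (p * ξ ^ 2 + r * ξ + C)) := by
    intro ξ
    have hw1 : 1 - 2 * (l * (γ / (2 * R) - γ / 2)) * s = N / R := by
      rw [hN, hS]
      field_simp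
      rw [hR]
      ring
    have := lintegral_exp_quadratic_gaussianReal hs (a := l * (γ / (2 * R) - γ / 2))
      (by rw [hw1]; exact hw) (l * (γ * β * (ξ / R - (α * x + ξ))))
      (l * (1 / 2 * K - γ * ξ ^ 2 / (2 * (1 - α ^ 2)) + γ * (β * ξ) ^ 2 / (2 * R)
        + γ / 2 * (1 - β ^ 2) * (α * x + ξ) ^ 2))
    rw [hw1] at this
    rw [← ENNReal.ofReal_mul (by positivity)]
    convert this using 1
    · refine lintegral_congr fun v => ?_
      congr 2
      ring
    · congr 3
      rw [hp, hr, hC, hS]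
      field_simp
      ring
  simp only [hinner]
  rw [lintegral_const_mul _ (by fun_prop)]
  have hw2 : 1 - 2 * p * s₁ = (M / R) / (N / R) := by
    rw [hp, hS1]
    exact entropy_exponent_quadratic_coeff hγ.ne' hq2.ne' hN0 hq1.ne' rfl hR hN hM
  rw [lintegral_exp_quadratic_gaussianReal hs1 (by rw [hw2]; exact div_pos hD hw), hw2,
    ← ENNReal.ofReal_mul (by positivity)]
  congr 1
  rw [Real.div_rpow hD.le hw.le, ← mul_assoc, mul_div_cancel₀ _ (by positivity), mul_comm _ (_ ^ _),
    mul_assoc, ← Real.exp_add, ← entropy_exponent_const (x := x) hγ.ne' hq2.ne' hN0 hM0 rfl hR hN hM]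
  congr 2
  rw [hC, hr, hS1]
  ring

theorem integrable_and_mgf_entropyLaw {κ γ t₁ t₂ : ℝ} (hκ : 0 < κ) (hγ : 0 < γ) (ht₁ : 0 < t₁)
    (ht : t₁ < t₂) (x : ℝ) {l : ℝ} (hD : 0 < quadD κ γ t₁ t₂ l) :
    Integrable (fun y => Real.exp (l * y)) (entropyLaw κ γ x t₁ t₂) ∧
      mgf id (entropyLaw κ γ x t₁ t₂) l = mgf1 κ γ x t₁ t₂ l := by
  refine integrable_and_integral_eq_of_lintegral (by fun_prop) (fun y => (Real.exp_pos _).le) ?_ ?_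
  · have hq1 := sub_pos.2 (q_lt_one hκ hγ ht₁)
    have hq2 := sub_pos.2 (q_lt_one hκ hγ (ht₁.trans ht))
    unfold mgf1
    positivity
  · rw [entropyLaw, lintegral_map (by fun_prop) (measurable_entropyFun _ _ _ _ _)]
    exact lintegral_exp_entropyFun hκ hγ ht₁ ht x hD

/-! ### Uniqueness from the moment-generating function near zero -/

/-- Both complex moment-generating functions are analytic on the strip `|Re z| < ε`. By the identity
theorem, agreement on real points near `0` extends to the imaginary axis, that is, to the
characteristic functions. -/
theorem ext_of_mgf_eq_near_zero {μ ν : Measure ℝ} [IsFiniteMeasure μ] [IsFiniteMeasure ν]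
    {ε : ℝ} (hε : 0 < ε)
    (hμ : ∀ l ∈ Set.Ioo (-ε) ε, Integrable (fun x => Real.exp (l * x)) μ)
    (hν : ∀ l ∈ Set.Ioo (-ε) ε, Integrable (fun x => Real.exp (l * x)) ν)
    (h : ∀ l ∈ Set.Ioo (-ε) ε, mgf id μ l = mgf id ν l) : μ = ν := by
  have hsub : ∀ {ρ : Measure ℝ}, (∀ l ∈ Set.Ioo (-ε) ε, Integrable (fun x => Real.exp (l * x)) ρ) →
      AnalyticOnNhd ℂ (complexMGF id ρ) {z : ℂ | z.re ∈ Set.Ioo (-ε) ε} := fun {ρ} hρ =>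
    (analyticOnNhd_complexMGF (X := id) (μ := ρ)).mono fun z hz =>
      interior_maximal (fun l hl => hρ l hl) isOpen_Ioo hz
  have hconv : Convex ℝ {z : ℂ | z.re ∈ Set.Ioo (-ε) ε} :=
    (convex_Ioo (-ε) ε).linear_preimage Complex.reLm
  have h0 : (0 : ℝ) ∈ Set.Ioo (-ε) ε := ⟨by linarith, hε⟩
  have heq : Set.EqOn (complexMGF id μ) (complexMGF id ν) {z : ℂ | z.re ∈ Set.Ioo (-ε) ε} := by
    refine AnalyticOnNhd.eqOn_of_preconnected_of_frequently_eq (hsub hμ) (hsub hν)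
      hconv.isPreconnected (z₀ := ((0 : ℝ) : ℂ)) (by simpa using hε) ?_
    have h_real : ∃ᶠ x : ℝ in 𝓝[≠] 0, complexMGF id μ x = complexMGF id ν x := by
      refine Eventually.frequently ?_
      filter_upwards [nhdsWithin_le_nhds (isOpen_Ioo.mem_nhds h0)] with x hx
      rw [complexMGF_ofReal, complexMGF_ofReal, h x hx]
    have ht : Tendsto (fun x : ℝ => (x : ℂ)) (𝓝[≠] (0 : ℝ)) (𝓝[≠] ((0 : ℝ) : ℂ)) := by
      refine tendsto_nhdsWithin_iff.2 ⟨?_, ?_⟩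
      · exact (Complex.continuous_ofReal.tendsto 0).mono_left nhdsWithin_le_nhds
      · filter_upwards [self_mem_nhdsWithin] with x hx
        simpa using hx
    exact ht.frequently h_real
  apply Measure.ext_of_charFun
  ext t
  rw [← complexMGF_id_mul_I, ← complexMGF_id_mul_I]
  exact heq (by simpa using hε)

/-! ### The `K`-distribution -/

lemma sq_div_four_le_cosh (u : ℝ) : u ^ 2 / 4 ≤ Real.cosh u := by
  rw [← Real.cosh_abs, Real.cosh_eq, ← sq_abs]
  have h1 := Real.quadratic_le_exp_of_nonneg (abs_nonneg u)
  have h2 := Real.add_one_le_exp (-|u|)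
  linarith

lemma integrable_exp_mul_exp_neg_cosh (ν : ℝ) {z : ℝ} (hz : 0 < z) :
    Integrable fun u : ℝ => Real.exp (ν * u) * Real.exp (-z * Real.cosh u) := by
  have hi := (integrable_exp_neg_mul_sq (b := z / 8) (by positivity)).const_mul
    (Real.exp (2 * ν ^ 2 / z))
  refine hi.mono' (Continuous.aestronglyMeasurable (by fun_prop)) (ae_of_all _ fun u => ?_)
  rw [Real.norm_of_nonneg (by positivity), ← Real.exp_add, ← Real.exp_add, Real.exp_le_exp]
  have h1 := mul_le_mul_of_nonneg_left (sq_div_four_le_cosh u) hz.le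
  -- Half of the Gaussian decay `z u² / 4` absorbs the linear term `ν u`; the other half is the
  -- dominating function.
  have h2 : 2 * ν ^ 2 / z + z / 8 * u ^ 2 - ν * u = (4 * ν - z * u) ^ 2 / (8 * z) := by
    field_simp
    ring
  have h3 : 0 ≤ (4 * ν - z * u) ^ 2 / (8 * z) := by positivity
  linarith

lemma integral_exp_mul_exp_neg_cosh (ν : ℝ) {z : ℝ} (hz : 0 < z) :
    ∫ u : ℝ, Real.exp (ν * u) * Real.exp (-z * Real.cosh u) = 2 * besselK ν z := by
  have h1 := integrable_exp_mul_exp_neg_cosh ν hz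
  have h2 := integrable_exp_mul_exp_neg_cosh (-ν) hz
  have h3 : ∫ u : ℝ, Real.exp (-ν * u) * Real.exp (-z * Real.cosh u) =
      ∫ u : ℝ, Real.exp (ν * u) * Real.exp (-z * Real.cosh u) := by
    rw [← integral_neg_eq_self]
    simp
  have h4 : ∫ u : ℝ, Real.exp (-z * Real.cosh |u|) * Real.cosh (ν * |u|) = 2 * besselK ν z :=
    integral_comp_abs (f := fun u => Real.exp (-z * Real.cosh u) * Real.cosh (ν * u))
  have h5 : (fun u : ℝ => Real.exp (-z * Real.cosh |u|) * Real.cosh (ν * |u|)) = fun u : ℝ =>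
      1 / 2 * (Real.exp (ν * u) * Real.exp (-z * Real.cosh u)
        + Real.exp (-ν * u) * Real.exp (-z * Real.cosh u)) := by
    ext u
    have : Real.cosh (ν * |u|) = Real.cosh (ν * u) := by
      rw [← Real.cosh_abs (ν * u), ← Real.cosh_abs (ν * |u|), abs_mul, abs_mul, abs_abs]
    rw [Real.cosh_abs, this, Real.cosh_eq (ν * u), neg_mul ν u]
    ring
  rw [h5, integral_const_mul, integral_add h1 h2, h3] at h4
  linarith

/-- The substitution `w = (y / 2b) e^u` balances the two terms of the exponent, whose sum becomes
`-b y cosh u`. -/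
lemma lintegral_rpow_mul_exp_eq_besselK (ν : ℝ) {b y : ℝ} (hb : 0 < b) (hy : 0 < y) :
    ∫⁻ w in Set.Ioi 0, ENNReal.ofReal (w ^ (ν - 1) * Real.exp (-y ^ 2 / (4 * w) - b ^ 2 * w)) =
      ENNReal.ofReal (2 * (y / (2 * b)) ^ ν * besselK ν (b * y)) := by
  set c := y / (2 * b) with hc
  have hc0 : 0 < c := by positivity
  have himg : (fun u : ℝ => c * Real.exp u) '' Set.univ = Set.Ioi 0 := by
    ext w
    simp only [Set.image_univ, Set.mem_range, Set.mem_Ioi]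
    constructor
    · rintro ⟨u, rfl⟩
      positivity
    · intro hw
      refine ⟨Real.log (w / c), ?_⟩
      rw [Real.exp_log (by positivity)]
      field_simp
  rw [← himg, lintegral_image_eq_lintegral_abs_deriv_mul MeasurableSet.univ
    (fun u _ => ((Real.hasDerivAt_exp u).const_mul c).hasDerivWithinAt)
    (fun u _ v _ huv => Real.exp_injective (mul_left_cancel₀ hc0.ne' huv)), setLIntegral_univ]
  have hz : 0 < b * y := by positivity
  have h1 : ∀ u : ℝ, ENNReal.ofReal |c * Real.exp u| *
      ENNReal.ofReal ((c * Real.exp u) ^ (ν - 1)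
        * Real.exp (-y ^ 2 / (4 * (c * Real.exp u)) - b ^ 2 * (c * Real.exp u))) =
      ENNReal.ofReal (c ^ ν * (Real.exp (ν * u) * Real.exp (-(b * y) * Real.cosh u))) := by
    intro u
    have hp : 0 < c * Real.exp u := by positivity
    rw [abs_of_pos hp, ← ENNReal.ofReal_mul hp.le, ← mul_assoc]
    congr 1
    rw [Real.rpow_sub_one hp.ne', mul_div_cancel₀ _ hp.ne', Real.mul_rpow hc0.le (Real.exp_pos u).le,
      ← Real.exp_mul, mul_comm u ν, mul_assoc]
    congr 3
    rw [Real.cosh_eq, Real.exp_neg, hc]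
    have := Real.exp_pos u
    field_simp
    ring
  rw [lintegral_congr h1, ← ofReal_integral_eq_lintegral_ofReal
    ((integrable_exp_mul_exp_neg_cosh ν hz).const_mul _) (ae_of_all _ fun u => by positivity),
    integral_const_mul, integral_exp_mul_exp_neg_cosh ν hz]
  congr 1
  ring

/-- The `K`-distribution as a mixture of normal distributions over a gamma distribution. -/
def kMixture (m p a x : ℝ) : ENNReal :=
  ∫⁻ w, gammaPDF m p w * gaussianPDF (2 * a * w) (2 * w).toNNReal x

lemma measurable_mixture_integrand (m p a : ℝ) : Measurable fun z : ℝ × ℝ =>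
    gammaPDF m p z.2 * gaussianPDF (2 * a * z.2) (2 * z.2).toNNReal z.1 := by
  have h1 : Measurable fun z : ℝ × ℝ => gammaPDF m p z.2 :=
    ((measurable_gammaPDFReal m p).comp measurable_snd).ennreal_ofReal
  have h2 : Measurable fun z : ℝ × ℝ => gaussianPDF (2 * a * z.2) (2 * z.2).toNNReal z.1 :=
    measurable_uncurry_gaussianPDF.comp
      (f := fun z : ℝ × ℝ => (2 * a * z.2, (2 * z.2).toNNReal, z.1)) (by fun_prop)
  exact h1.mul h2

lemma measurable_kMixture (m p a : ℝ) : Measurable (kMixture m p a) :=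
  (measurable_mixture_integrand m p a).lintegral_prod_right'

/-- For `w ≤ 0` the truncated variance is `0`, and the normal density of variance `0` is `0` by
convention. -/
lemma kMixture_eq_setLIntegral (m p a x : ℝ) : kMixture m p a x =
    ∫⁻ w in Set.Ioi 0, gammaPDF m p w * gaussianPDF (2 * a * w) (2 * w).toNNReal x := by
  have hs : Function.support (fun w => gammaPDF m p w * gaussianPDF (2 * a * w) (2 * w).toNNReal x)
      ⊆ Set.Ioi 0 := by
    intro w hw
    by_contra hcon
    have hw0 : 2 * w ≤ 0 := by
      have := not_lt.1 (show ¬ 0 < w from hcon)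
      linarith
    exact hw (by simp [Real.toNNReal_of_nonpos hw0])
  exact (setLIntegral_eq_of_support_subset hs).symm

/-- Expanding the square, the drift contributes `e^{a x}` and `e^{-a² w}`, which turns the gamma
rate `b² - a²` into `b²`; what remains is the Bessel integral. Its substitution needs `x ≠ 0`. -/
theorem kMixture_eq_kDensity {ν a b : ℝ} (hν : 0 < ν + 1 / 2) (hb : 0 < b) (hab : a ^ 2 < b ^ 2)
    {x : ℝ} (hx : x ≠ 0) :
    kMixture (ν + 1 / 2) (b ^ 2 - a ^ 2) a x = ENNReal.ofReal (kDensity ν a b x) := by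
  have hp : 0 < b ^ 2 - a ^ 2 := sub_pos.2 hab
  have hG := Real.Gamma_pos_of_pos hν
  have hx0 : 0 < |x| := abs_pos.2 hx
  set A := (b ^ 2 - a ^ 2) ^ (ν + 1 / 2) / (√Real.pi * Real.Gamma (ν + 1 / 2))
    * Real.exp (a * x) / 2 with hA
  have hA0 : 0 ≤ A := by positivity
  have h1 : ∀ w ∈ Set.Ioi (0 : ℝ),
      gammaPDF (ν + 1 / 2) (b ^ 2 - a ^ 2) w * gaussianPDF (2 * a * w) (2 * w).toNNReal x =
      ENNReal.ofReal A * ENNReal.ofReal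
        (w ^ (ν - 1) * Real.exp (-|x| ^ 2 / (4 * w) - b ^ 2 * w)) := by
    intro w hw
    have hw : 0 < w := hw
    rw [gammaPDF_of_nonneg hw.le, gaussianPDF, gaussianPDFReal,
      Real.coe_toNNReal _ (by positivity), ← ENNReal.ofReal_mul (by positivity),
      ← ENNReal.ofReal_mul hA0]
    congr 1
    have hsq : √(2 * Real.pi * (2 * w)) = 2 * √Real.pi * √w := by
      rw [show 2 * Real.pi * (2 * w) = 2 ^ 2 * (Real.pi * w) by ring, Real.sqrt_mul (by positivity),
        Real.sqrt_sq (by norm_num), Real.sqrt_mul Real.pi_pos.le]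
      ring
    have hpow : w ^ (ν + 1 / 2 - 1) = w ^ (ν - 1) * √w := by
      rw [Real.sqrt_eq_rpow, ← Real.rpow_add hw]
      congr 1
      ring
    have hexp : Real.exp (-((b ^ 2 - a ^ 2) * w)) * Real.exp (-(x - 2 * a * w) ^ 2 / (2 * (2 * w))) =
        Real.exp (a * x) * Real.exp (-|x| ^ 2 / (4 * w) - b ^ 2 * w) := by
      rw [← Real.exp_add, ← Real.exp_add, sq_abs]
      congr 1
      field_simp
      ring
    rw [hsq, hpow, hA]
    have hsw : √w ≠ 0 := by positivity
    have hspi : √Real.pi ≠ 0 := by positivity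
    calc _ = (b ^ 2 - a ^ 2) ^ (ν + 1 / 2) / Real.Gamma (ν + 1 / 2) * (w ^ (ν - 1) * √w)
          * (2 * √Real.pi * √w)⁻¹ * (Real.exp (-((b ^ 2 - a ^ 2) * w))
          * Real.exp (-(x - 2 * a * w) ^ 2 / (2 * (2 * w)))) := by ring
      _ = _ := by
        rw [hexp]
        field_simp
  rw [kMixture_eq_setLIntegral, setLIntegral_congr_fun measurableSet_Ioi h1,
    lintegral_const_mul _ (by fun_prop), lintegral_rpow_mul_exp_eq_besselK ν hb hx0,
    ← ENNReal.ofReal_mul hA0]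
  congr 1
  rw [kDensity, hA, abs_div, abs_of_pos (by positivity : 0 < 2 * b)]
  ring

/-- For fixed `w` the normal law contributes `e^{(2al + l²) w}`, which tilts the gamma law to the
rate `r = p - (2al + l²)`. -/
theorem lintegral_exp_mul_kMixture {m p a l : ℝ} (hm : 0 < m) (hp : 0 < p)
    (hl : 0 < p - (2 * a * l + l ^ 2)) :
    ∫⁻ x, ENNReal.ofReal (Real.exp (l * x)) * kMixture m p a x =
      ENNReal.ofReal ((p / (p - (2 * a * l + l ^ 2))) ^ m) := by
  have hm1 := measurable_mixture_integrand m p a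
  have hm2 : Measurable fun z : ℝ × ℝ => ENNReal.ofReal (Real.exp (l * z.1)) *
      (gammaPDF m p z.2 * gaussianPDF (2 * a * z.2) (2 * z.2).toNNReal z.1) := by
    fun_prop
  have h1 : ∀ x, ENNReal.ofReal (Real.exp (l * x)) * kMixture m p a x =
      ∫⁻ w in Set.Ioi 0, ENNReal.ofReal (Real.exp (l * x)) *
        (gammaPDF m p w * gaussianPDF (2 * a * w) (2 * w).toNNReal x) := by
    intro x
    rw [kMixture_eq_setLIntegral, lintegral_const_mul]
    exact hm1.comp (measurable_prodMk_left (x := x))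
  rw [lintegral_congr h1, lintegral_lintegral_swap hm2.aemeasurable]
  set r := p - (2 * a * l + l ^ 2) with hr
  have h2 : ∀ w ∈ Set.Ioi (0 : ℝ), ∫⁻ x, ENNReal.ofReal (Real.exp (l * x)) *
        (gammaPDF m p w * gaussianPDF (2 * a * w) (2 * w).toNNReal x) =
      ENNReal.ofReal ((p / r) ^ m) * gammaPDF m r w := by
    intro w hw
    have hw : 0 < w := hw
    have hw2 : (2 * w).toNNReal ≠ 0 := by simpa using hw
    have hG := Real.Gamma_pos_of_pos hm
    have e1 : ∀ x, ENNReal.ofReal (Real.exp (l * x)) *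
        (gammaPDF m p w * gaussianPDF (2 * a * w) (2 * w).toNNReal x) =
        gammaPDF m p w * (gaussianPDF (2 * a * w) (2 * w).toNNReal x *
          ENNReal.ofReal (Real.exp (l * x))) := fun x => by ring
    rw [lintegral_congr e1, lintegral_const_mul _ (by fun_prop)]
    have e2 : ∫⁻ x, gaussianPDF (2 * a * w) (2 * w).toNNReal x * ENNReal.ofReal (Real.exp (l * x)) =
        ENNReal.ofReal (Real.exp ((2 * a * l + l ^ 2) * w)) := by
      have := lintegral_withDensity_eq_lintegral_mul volume
        (measurable_gaussianPDF (2 * a * w) (2 * w).toNNReal)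
        (g := fun x => ENNReal.ofReal (Real.exp (l * x))) (by fun_prop)
      simp only [Pi.mul_apply] at this
      rw [← this, ← gaussianReal_of_var_ne_zero _ hw2, ← ofReal_integral_eq_lintegral_ofReal
        (integrable_exp_mul_gaussianReal l) (ae_of_all _ fun x => (Real.exp_pos _).le)]
      have h := congrFun (mgf_id_gaussianReal (μ := 2 * a * w) (v := (2 * w).toNNReal)) l
      simp only [mgf, id] at h
      rw [h, Real.coe_toNNReal _ (by positivity)]
      congr 2
      ring
    rw [e2, gammaPDF_of_nonneg hw.le, gammaPDF_of_nonneg hw.le, ← ENNReal.ofReal_mul (by positivity),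
      ← ENNReal.ofReal_mul (by positivity)]
    congr 1
    rw [Real.div_rpow hp.le hl.le, mul_assoc, ← Real.exp_add]
    have : r ^ m ≠ 0 := by positivity
    have e3 : -(p * w) + (2 * a * l + l ^ 2) * w = -(r * w) := by rw [hr]; ring
    rw [e3]
    field_simp
  have hgm : Measurable (gammaPDF m r) := (measurable_gammaPDFReal m r).ennreal_ofReal
  rw [setLIntegral_congr_fun measurableSet_Ioi h2, lintegral_const_mul _ hgm]
  have h3 : ∫⁻ w in Set.Ioi 0, gammaPDF m r w = 1 := by
    rw [← lintegral_gammaPDF_eq_one hm hl, setLIntegral_congr Ioi_ae_eq_Ici]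
    refine setLIntegral_eq_of_support_subset fun w hw => ?_
    by_contra hcon
    exact hw (gammaPDF_of_neg (not_le.1 hcon))
  rw [h3, mul_one]

lemma map_add_withDensity (f : ℝ → ENNReal) (s : ℝ) :
    (volume.withDensity f).map (fun x => x + s) = volume.withDensity fun x => f (x - s) := by
  ext A hA
  have hm : MeasurableSet ((fun x : ℝ => x + s) ⁻¹' A) := (measurable_add_const s) hA
  rw [Measure.map_apply (measurable_add_const s) hA, withDensity_apply _ hm,
    withDensity_apply _ hA, ← lintegral_indicator hm, ← lintegral_indicator hA,
    ← lintegral_add_right_eq_self (A.indicator fun x => f (x - s)) s]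
  refine lintegral_congr fun x => ?_
  by_cases h : x + s ∈ A
  · rw [Set.indicator_of_mem (s := (fun x => x + s) ⁻¹' A) h, Set.indicator_of_mem h,
      add_sub_cancel_right]
  · rw [Set.indicator_of_notMem (s := (fun x => x + s) ⁻¹' A) h, Set.indicator_of_notMem h]

theorem withDensity_kDensity_sub_eq_map {ν a b : ℝ} (hν : 0 < ν + 1 / 2) (hb : 0 < b)
    (hab : a ^ 2 < b ^ 2) (s : ℝ) :
    volume.withDensity (fun x => ENNReal.ofReal (kDensity ν a b (x - s))) =
      (volume.withDensity (kMixture (ν + 1 / 2) (b ^ 2 - a ^ 2) a)).map (fun x => x + s) := by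
  rw [map_add_withDensity]
  refine withDensity_congr_ae ?_
  have h : ∀ᵐ x : ℝ, x ≠ s := by simp [ae_iff]
  filter_upwards [h] with x hx
  rw [kMixture_eq_kDensity hν hb hab (sub_ne_zero.2 hx)]

theorem lintegral_exp_mul_kDensity_sub {ν a b l : ℝ} (hν : 0 < ν + 1 / 2) (hb : 0 < b)
    (hab : a ^ 2 < b ^ 2) (s : ℝ) (hl : 0 < b ^ 2 - a ^ 2 - (2 * a * l + l ^ 2)) :
    ∫⁻ x, ENNReal.ofReal (Real.exp (l * x))
        ∂(volume.withDensity (fun x => ENNReal.ofReal (kDensity ν a b (x - s)))) =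
      ENNReal.ofReal (Real.exp (l * s)
        * ((b ^ 2 - a ^ 2) / (b ^ 2 - a ^ 2 - (2 * a * l + l ^ 2))) ^ (ν + 1 / 2)) := by
  rw [withDensity_kDensity_sub_eq_map hν hb hab, lintegral_map (by fun_prop) (by fun_prop),
    lintegral_withDensity_eq_lintegral_mul _ (measurable_kMixture _ _ _) (by fun_prop),
    ENNReal.ofReal_mul (Real.exp_pos _).le,
    ← lintegral_exp_mul_kMixture hν (sub_pos.2 hab) hl,
    ← lintegral_const_mul (ENNReal.ofReal (Real.exp (l * s)))
      (f := fun x => ENNReal.ofReal (Real.exp (l * x)) *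
        kMixture (ν + 1 / 2) (b ^ 2 - a ^ 2) a x)
      (Measurable.mul (by fun_prop) (measurable_kMixture _ _ _))]
  refine lintegral_congr fun x => ?_
  rw [Pi.mul_apply, mul_add, Real.exp_add, ENNReal.ofReal_mul (Real.exp_pos _).le]
  ring

/-! ### Sums of independent real random variables -/

section Sums

variable {Ω : Type*} [MeasurableSpace Ω] {P : Measure Ω}

lemma indepFun_sum_succ {n : ℕ} {X : Fin (n + 1) → Ω → ℝ} (h : iIndepFun X P)
    (hX : ∀ r, AEMeasurable (X r) P) : IndepFun (fun ω => ∑ r, X (Fin.succ r) ω) (X 0) P := by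
  have := h.indepFun_finsetSum_of_notMem₀ hX
    (s := Finset.univ.map (Fin.succEmb n)) (i := 0) (by simp [Fin.succ_ne_zero])
  rw [Finset.sum_map] at this
  convert! this using 1
  ext ω
  simp

theorem map_sum_eq_convolution {d : ℕ} {X : Fin d → Ω → ℝ} (h : iIndepFun X P)
    (hX : ∀ r, AEMeasurable (X r) P) :
    P.map (fun ω => ∑ r, X r ω) = convolution fun r => P.map (X r) := by
  have := h.isProbabilityMeasure
  induction d with
  | zero => simp [convolution, Measure.map_const]
  | succ n ih =>
    have h1 := (indepFun_sum_succ h hX).symm.map_add_eq_map_conv_map₀ (hX 0)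
      (Finset.aemeasurable_fun_sum _ fun r _ => hX r.succ)
    rw [ih (h.precomp (Fin.succ_injective n)) fun r => hX r.succ] at h1
    rw [convolution, List.ofFn_succ, List.foldr_cons]
    refine Eq.trans ?_ h1
    congr with ω
    simp [Fin.sum_univ_succ]

/-- Convolution with one absolutely continuous law suffices; `0 < d` excludes the empty sum, whose
law is a Dirac mass. -/
theorem map_sum_absolutelyContinuous {d : ℕ} (hd : 0 < d) {X : Fin d → Ω → ℝ}
    (h : iIndepFun X P) (hX : ∀ r, AEMeasurable (X r) P) (hac : ∀ r, P.map (X r) ≪ volume) :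
    P.map (fun ω => ∑ r, X r ω) ≪ volume := by
  have := h.isProbabilityMeasure
  obtain ⟨n, rfl⟩ : ∃ n, d = n + 1 := ⟨d - 1, by omega⟩
  have h1 := (indepFun_sum_succ h hX).map_add_eq_map_conv_map₀
    (Finset.aemeasurable_fun_sum _ fun r _ => hX r.succ) (hX 0)
  have h2 : P.map (fun ω => ∑ r, X r ω) ≪ volume ↔
      P.map ((fun ω => ∑ r, X (Fin.succ r) ω) + X 0) ≪ volume := by
    rw [show (fun ω => ∑ r, X r ω) = (fun ω => ∑ r, X (Fin.succ r) ω) + X 0 by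
      ext ω
      simp [Fin.sum_univ_succ, add_comm]]
  rw [h2, h1]
  exact Measure.conv_absolutelyContinuous (hac 0)

theorem integrable_cexp_mul_sum {d : ℕ} {X : Fin d → Ω → ℝ} (h : iIndepFun X P)
    (hX : ∀ r, Measurable (X r)) {z : ℂ}
    (hz : ∀ r, Integrable (fun ω => Real.exp (z.re * X r ω)) P) :
    Integrable (fun ω => Complex.exp (z * ((∑ r, X r ω : ℝ) : ℂ))) P := by
  have := h.isProbabilityMeasure
  have h1 := h.integrable_exp_mul_sum hX (s := Finset.univ) fun r _ => hz r
  refine h1.congr' (by fun_prop) (ae_of_all _ fun ω => ?_)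
  simp [Complex.norm_exp]

theorem complexMGF_sum {d : ℕ} {X : Fin d → Ω → ℝ} (h : iIndepFun X P)
    (hX : ∀ r, AEMeasurable (X r) P) (z : ℂ) :
    complexMGF (fun ω => ∑ r, X r ω) P z = ∏ r, complexMGF (X r) P z := by
  have := h.integral_fun_prod_comp (f := fun _ (x : ℝ) => Complex.exp (z * (x : ℂ))) hX
    fun r => by fun_prop
  unfold complexMGF
  rw [← this]
  congr with ω
  push_cast
  rw [Finset.mul_sum, Complex.exp_sum]

end Sums

/-! ### Products of densities -/

/-- It suffices to compare on boxes, where the indicator factorises along with the density. -/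
lemma pi_withDensity_eq {d : ℕ} {f : Fin d → ℝ → ℝ} (hf : ∀ r x, 0 ≤ f r x)
    (hi : ∀ r, Integrable (f r)) :
    Measure.pi (fun r => volume.withDensity fun x => ENNReal.ofReal (f r x)) =
      volume.withDensity fun x => ENNReal.ofReal (∏ r, f r (x r)) := by
  have hfin : ∀ r, IsFiniteMeasure (volume.withDensity fun x => ENNReal.ofReal (f r x)) :=
    fun r => isFiniteMeasure_withDensity_ofReal (hi r).2
  refine Measure.pi_eq fun s hs => ?_
  rw [withDensity_apply _ (MeasurableSet.univ_pi hs), ← lintegral_indicator (.univ_pi hs)]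
  have h1 : ∀ r, Integrable ((s r).indicator (f r)) := fun r => (hi r).indicator (hs r)
  have h0 : ∀ r x, 0 ≤ (s r).indicator (f r) x := fun r x =>
    Set.indicator_nonneg (fun x _ => hf r x) x
  have h2 : ∀ x : Fin d → ℝ, (Set.univ.pi s).indicator
      (fun x => ENNReal.ofReal (∏ r, f r (x r))) x =
        ENNReal.ofReal (∏ r, (s r).indicator (f r) (x r)) := by
    intro x
    by_cases hx : x ∈ Set.univ.pi s
    · rw [Set.indicator_of_mem hx]
      congr 1
      exact Finset.prod_congr rfl fun r _ => (Set.indicator_of_mem (hx r trivial) _).symm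
    · rw [Set.indicator_of_notMem hx]
      simp only [Set.mem_univ_pi, not_forall] at hx
      obtain ⟨r, hr⟩ := hx
      rw [Finset.prod_eq_zero (Finset.mem_univ r) (Set.indicator_of_notMem hr _),
        ENNReal.ofReal_zero]
  rw [lintegral_congr h2, volume_pi, ← ofReal_integral_eq_lintegral_ofReal
      (Integrable.fintype_prod (f := fun r => (s r).indicator (f r)) h1)
      (ae_of_all _ fun x => Finset.prod_nonneg fun r _ => h0 r _),
    integral_fintype_prod_eq_prod (f := fun r => (s r).indicator (f r)),
    ENNReal.ofReal_prod_of_nonneg fun r _ => integral_nonneg (h0 r)]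
  refine Finset.prod_congr rfl fun r _ => ?_
  rw [withDensity_apply _ (hs r), integral_indicator (hs r),
    ofReal_integral_eq_lintegral_ofReal (hi r).restrict (ae_of_all _ (hf r))]

/-! ### The processes along the principal axes -/

section PrincipalAxes

variable {Ω : Type*} [MeasurableSpace Ω] {P : Measure Ω} {κ : ℝ}

/-- The law of the entropy production of a real Ornstein-Uhlenbeck process. -/
theorem IsOURaw.map_entropy1 {γ x₀ : ℝ} {B X : ℝ≥0 → Ω → ℝ} (hκ : 0 < κ) (hγ : 0 < γ)
    (h : IsOURaw (κ * γ) √(2 * κ) x₀ B X P) {t₁ t₂ : ℝ≥0} (ht : t₁ ≤ t₂) :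
    P.map (fun ω => entropy1 κ γ x₀ t₁ t₂ (X t₁ ω) (X t₂ ω)) = entropyLaw κ γ x₀ t₁ t₂ := by
  have h1 := h.map_pair_eq_prod hκ hγ t₁ (t₂ - t₁)
  rw [add_tsub_cancel_of_le ht, NNReal.coe_sub ht] at h1
  have hm : Measurable fun ω => (X t₁ ω - Real.exp (-(κ * γ * t₁)) * x₀,
      X t₂ ω - Real.exp (-(κ * γ * (t₂ - t₁))) * X t₁ ω) :=
    ((h.measurable t₁).sub_const _).prodMk ((h.measurable t₂).sub ((h.measurable t₁).const_mul _))
  rw [entropyLaw, ← h1, Measure.map_map (measurable_entropyFun _ _ _ _ _) hm]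
  congr with ω
  simp [entropyFun]

lemma measurable_entropy1 (κ γ x t₁ t₂ : ℝ) :
    Measurable fun p : ℝ × ℝ => entropy1 κ γ x t₁ t₂ p.1 p.2 := by
  unfold entropy1
  fun_prop

lemma IsOURaw.measurable_entropy1 {c σ x₀ : ℝ} {B X : ℝ≥0 → Ω → ℝ}
    (h : IsOURaw c σ x₀ B X P) (γ x : ℝ) (t₁ t₂ : ℝ≥0) :
    Measurable fun ω => entropy1 κ γ x t₁ t₂ (X t₁ ω) (X t₂ ω) := by
  have h1 := (h.measurable t₁).prodMk (h.measurable t₂)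
  have h2 := (OU.measurable_entropy1 κ γ x t₁ t₂).comp h1
  exact h2

variable {d : ℕ} {Γ : Matrix (Fin d) (Fin d) ℝ} {y₀ : EuclideanSpace ℝ (Fin d)}
  {W Y : ℝ≥0 → Ω → EuclideanSpace ℝ (Fin d)}
  {e : OrthonormalBasis (Fin d) ℝ (EuclideanSpace ℝ (Fin d))} {γ : Fin d → ℝ}

lemma eigenvalue_pos (hΓ : Γ.PosDef) (he : ∀ r, Matrix.toEuclideanLin Γ (e r) = γ r • e r)
    (r : Fin d) : 0 < γ r := by
  have h0 : (e r).ofLp ≠ 0 := by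
    have := e.orthonormal.ne_zero r
    simpa using this
  have h1 := hΓ.dotProduct_mulVec_pos h0
  have h2 : Γ *ᵥ (e r).ofLp = γ r • (e r).ofLp := congrArg WithLp.ofLp (he r)
  rw [h2, star_trivial, dotProduct_smul, smul_eq_mul] at h1
  have h3 : 0 ≤ (e r).ofLp ⬝ᵥ (e r).ofLp := Finset.sum_nonneg fun i _ => mul_self_nonneg _
  exact pos_of_mul_pos_left h1 h3

/-- Each pair is almost surely a measurable functional of its own driving path, and the driving
paths are independent. -/
theorem iIndepFun_inner_pair [IsProbabilityMeasure P] (hκ : 0 < κ)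
    (hY : IsOrnsteinUhlenbeck κ Γ y₀ W Y P)
    (he : ∀ r, Matrix.toEuclideanLin Γ (e r) = γ r • e r) {t₁ t₂ : ℝ≥0} (ht : t₁ ≤ t₂) :
    iIndepFun (fun r ω => (inner ℝ (e r) (Y t₁ ω), inner ℝ (e r) (Y t₂ ω))) P := by
  have h1 := (hY.brownian.iIndepFun_inner e).comp
    (fun r => ouPair (κ * γ r) √(2 * κ) (inner ℝ (e r) y₀) t₁ (t₂ - t₁))
    fun r => measurable_ouPair _ _ _ _ _
  refine h1.congr fun r => ?_
  have h2 := (hY.inner_eigenvector (transpose_eq_self he) (e.orthonormal.1 r) (he r)).ae_eq_ouPair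
    (by positivity) t₁ (t₂ - t₁)
  rw [add_tsub_cancel_of_le ht] at h2
  exact h2.symm

theorem iIndepFun_entropy1 [IsProbabilityMeasure P] (hκ : 0 < κ)
    (hY : IsOrnsteinUhlenbeck κ Γ y₀ W Y P)
    (he : ∀ r, Matrix.toEuclideanLin Γ (e r) = γ r • e r) {t₁ t₂ : ℝ≥0} (ht : t₁ ≤ t₂) :
    iIndepFun (fun r ω => entropy1 κ (γ r) (inner ℝ (e r) y₀) t₁ t₂
      (inner ℝ (e r) (Y t₁ ω)) (inner ℝ (e r) (Y t₂ ω))) P :=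
  (iIndepFun_inner_pair hκ hY he ht).comp _ fun r =>
    measurable_entropy1 κ (γ r) (inner ℝ (e r) y₀) t₁ t₂

/-- The eigenbasis coordinates are independent and Gaussian; the isometry back to the original
coordinates preserves volume, so no Jacobian appears. -/
theorem map_eq_withDensity_transDensity [IsProbabilityMeasure P] (hκ : 0 < κ) (hΓ : Γ.PosDef)
    (hY : IsOrnsteinUhlenbeck κ Γ y₀ W Y P)
    (he : ∀ r, Matrix.toEuclideanLin Γ (e r) = γ r • e r) {t : ℝ≥0} (ht : 0 < t) :
    P.map (Y t) = volume.withDensity fun y => ENNReal.ofReal (transDensity κ Γ t y₀ y) := by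
  have hγ := eigenvalue_pos hΓ he
  have hX := fun r =>
    hY.inner_eigenvector (transpose_eq_self he) (e.orthonormal.1 r) (he r)
  have hv : ∀ r, (ouVar κ (γ r) t).toNNReal ≠ 0 := fun r => by
    simpa using ouVar_pos hκ (hγ r) (t := t) ht
  have h1 : P.map (fun ω r => inner ℝ (e r) (Y t ω)) = volume.withDensity fun x =>
      ENNReal.ofReal (∏ r, gaussianPDFReal (Real.exp (-(κ * γ r * t)) * inner ℝ (e r) y₀)
        (ouVar κ (γ r) t).toNNReal (x r)) := by
    rw [iIndepFun.map_fun_eq_pi_map (fun r => ((hX r).measurable t).aemeasurable)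
      ((iIndepFun_inner_pair hκ hY he le_rfl).comp (fun _ => Prod.fst) fun _ => measurable_fst),
      ← pi_withDensity_eq (fun r => gaussianPDFReal_nonneg _ _)
        (fun r => integrable_gaussianPDFReal _ _)]
    congr with r : 1
    exact ((hX r).map_eq_gaussianReal hκ (hγ r) t).trans (gaussianReal_of_var_ne_zero _ (hv r))
  have hmp : MeasurePreserving (fun y : EuclideanSpace ℝ (Fin d) => (e.repr y).ofLp) :=
    (PiLp.volume_preserving_ofLp (Fin d)).comp e.measurePreserving_repr
  ext A hA
  have hA' : MeasurableSet ((fun x : Fin d → ℝ => e.repr.symm (WithLp.toLp 2 x)) ⁻¹' A) :=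
    (e.measurePreserving_repr_symm.comp (PiLp.volume_preserving_toLp (Fin d))).measurable hA
  have hp : (fun y : EuclideanSpace ℝ (Fin d) => (e.repr y).ofLp) ⁻¹'
      ((fun x : Fin d → ℝ => e.repr.symm (WithLp.toLp 2 x)) ⁻¹' A) = A := by
    ext y
    simp
  have hm : Measurable fun ω r => inner ℝ (e r) (Y t ω) :=
    measurable_pi_lambda _ fun r => (hX r).measurable t
  have h2 : P.map (Y t) A = P.map (fun ω r => inner ℝ (e r) (Y t ω))
      ((fun x : Fin d → ℝ => e.repr.symm (WithLp.toLp 2 x)) ⁻¹' A) := by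
    rw [Measure.map_apply (hY.measurable t) hA, Measure.map_apply hm hA']
    conv_lhs => rw [← hp]
    congr 1
    ext ω
    simp only [Set.mem_preimage]
    congr! 3
    ext r
    simp [e.repr_apply_apply]
  rw [h2, h1, withDensity_apply _ hA', withDensity_apply _ hA,
    ← hmp.setLIntegral_comp_preimage hA' (by fun_prop), hp]
  refine lintegral_congr fun y => ?_
  rw [transDensity_eq_prod he hκ hγ (NNReal.coe_pos.2 ht)]
  simp [e.repr_apply_apply]

end PrincipalAxes

/-! ### One-dimensional models and projections onto eigenvectors -/

section OneDimensional

variable {Ω : Type*} [MeasurableSpace Ω] {P : Measure Ω} {κ : ℝ}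

lemma toEuclideanLin_gen1 (γ : ℝ) (x : EuclideanSpace ℝ (Fin 1)) :
    Matrix.toEuclideanLin (gen1 γ) x = γ • x := by
  simp [gen1]

lemma IsOrnsteinUhlenbeck.isOURaw_gen1 [IsProbabilityMeasure P] {γ : ℝ}
    {z₀ : EuclideanSpace ℝ (Fin 1)} {W Z : ℝ≥0 → Ω → EuclideanSpace ℝ (Fin 1)}
    (hZ : IsOrnsteinUhlenbeck κ (gen1 γ) z₀ W Z P) :
    IsOURaw (κ * γ) √(2 * κ) (z₀ 0) (fun t ω => W t ω 0) (fun t ω => Z t ω 0) P := by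
  have h := hZ.inner_eigenvector (by simp [gen1]) (v := EuclideanSpace.single 0 1) (by simp)
    (toEuclideanLin_gen1 γ _)
  simpa [EuclideanSpace.inner_single_left] using h

section Entropy

variable [IsProbabilityMeasure P] {γ : ℝ} {z₀ : EuclideanSpace ℝ (Fin 1)}
  {W Z : ℝ≥0 → Ω → EuclideanSpace ℝ (Fin 1)} {t₁ t₂ : ℝ≥0}

lemma measurable_entropy_gen1 (hκ : 0 < κ) (hγ : 0 < γ)
    (hZ : IsOrnsteinUhlenbeck κ (gen1 γ) z₀ W Z P) (ht₁ : 0 < t₁) (ht : t₁ < t₂) :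
    Measurable (entropy κ (gen1 γ) z₀ t₁ t₂ Z) := by
  have h : entropy κ (gen1 γ) z₀ t₁ t₂ Z =
      fun ω => entropy1 κ γ (z₀ 0) t₁ t₂ (Z t₁ ω 0) (Z t₂ ω 0) :=
    funext (entropy_gen1 hκ hγ ht₁ ht z₀ Z)
  rw [h]
  exact hZ.isOURaw_gen1.measurable_entropy1 γ (z₀ 0) t₁ t₂

theorem map_entropy_gen1 (hκ : 0 < κ) (hγ : 0 < γ)
    (hZ : IsOrnsteinUhlenbeck κ (gen1 γ) z₀ W Z P) (ht₁ : 0 < t₁) (ht : t₁ < t₂) :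
    P.map (entropy κ (gen1 γ) z₀ t₁ t₂ Z) = entropyLaw κ γ (z₀ 0) t₁ t₂ := by
  rw [funext (entropy_gen1 hκ hγ ht₁ ht z₀ Z)]
  exact hZ.isOURaw_gen1.map_entropy1 hκ hγ ht.le

theorem hasPDF_entropy_gen1 (hκ : 0 < κ) (hγ : 0 < γ)
    (hZ : IsOrnsteinUhlenbeck κ (gen1 γ) z₀ W Z P) (ht₁ : 0 < t₁) (ht : t₁ < t₂) :
    HasPDF (entropy κ (gen1 γ) z₀ t₁ t₂ Z) P volume := by
  refine ⟨(measurable_entropy_gen1 hκ hγ hZ ht₁ ht).aemeasurable, inferInstance, ?_⟩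
  rw [map_entropy_gen1 hκ hγ hZ ht₁ ht]
  exact entropyLaw_absolutelyContinuous hκ hγ ht₁ ht _

theorem integrable_and_mgf_entropy_gen1 (hκ : 0 < κ) (hγ : 0 < γ)
    (hZ : IsOrnsteinUhlenbeck κ (gen1 γ) z₀ W Z P) (ht₁ : 0 < t₁) (ht : t₁ < t₂) {l : ℝ}
    (hD : 0 < quadD κ γ t₁ t₂ l) :
    Integrable (fun ω => Real.exp (l * entropy κ (gen1 γ) z₀ t₁ t₂ Z ω)) P ∧
      mgf (entropy κ (gen1 γ) z₀ t₁ t₂ Z) P l = mgf1 κ γ (z₀ 0) t₁ t₂ l := by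
  have hm := measurable_entropy_gen1 hκ hγ hZ ht₁ ht
  have h := integrable_and_mgf_entropyLaw hκ hγ (NNReal.coe_pos.2 ht₁) (NNReal.coe_lt_coe.2 ht)
    (z₀ 0) hD
  rw [← map_entropy_gen1 hκ hγ hZ ht₁ ht, mgf_id_map hm.aemeasurable,
    integrable_map_measure (by fun_prop) hm.aemeasurable] at h
  exact h

end Entropy

variable {d : ℕ} {Γ : Matrix (Fin d) (Fin d) ℝ} {y₀ : EuclideanSpace ℝ (Fin d)}
  {W Y : ℝ≥0 → Ω → EuclideanSpace ℝ (Fin d)}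

lemma continuous_coordAlong (v : EuclideanSpace ℝ (Fin d)) : Continuous (coordAlong v) :=
  (PiLp.continuous_toLp 2 _).comp (continuous_pi fun i => by
    rw [Subsingleton.elim i 0]
    exact continuous_const.inner continuous_id)

lemma IsBrownian.coordAlong [IsProbabilityMeasure P] (hW : IsBrownian W P)
    {v : EuclideanSpace ℝ (Fin d)} (hv : ‖v‖ = 1) :
    IsBrownian (fun t ω => coordAlong v (W t ω)) P where
  measurable t := (continuous_coordAlong v).measurable.comp (hW.measurable t)
  coord i := by
    rw [Subsingleton.elim i 0]
    exact hW.isBrownianReal_inner hv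
  indep := iIndepFun.of_subsingleton

theorem IsOrnsteinUhlenbeck.coordAlong [IsProbabilityMeasure P]
    (hY : IsOrnsteinUhlenbeck κ Γ y₀ W Y P) (hΓ : Γᵀ = Γ) {v : EuclideanSpace ℝ (Fin d)}
    (hv : ‖v‖ = 1) {γ : ℝ} (hvγ : Matrix.toEuclideanLin Γ v = γ • v) :
    IsOrnsteinUhlenbeck κ (gen1 γ) (coordAlong v y₀) (fun t ω => coordAlong v (W t ω))
      (fun t ω => coordAlong v (Y t ω)) P where
  brownian := hY.brownian.coordAlong hv
  measurable t := (continuous_coordAlong v).measurable.comp (hY.measurable t)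
  cont := by
    filter_upwards [hY.cont] with ω h
    exact (continuous_coordAlong v).comp h
  eqn := by
    filter_upwards [hY.cont, (hY.inner_eigenvector hΓ hv hvγ).eqn] with ω h1 h2 t
    have hc : Continuous fun s : ℝ => γ • OU.coordAlong v (Y s.toNNReal ω) :=
      ((continuous_coordAlong v).comp (h1.comp continuous_real_toNNReal)).const_smul γ
    have h3 := (EuclideanSpace.proj (𝕜 := ℝ) (0 : Fin 1)).intervalIntegral_comp_comm
      (hc.intervalIntegrable (μ := volume) 0 t)
    have h4 : ∫ s in (0 : ℝ)..t, EuclideanSpace.proj (𝕜 := ℝ) (0 : Fin 1)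
        (γ • OU.coordAlong v (Y s.toNNReal ω)) =
          γ * ∫ s in (0 : ℝ)..t, inner ℝ v (Y s.toNNReal ω) := by
      rw [← intervalIntegral.integral_const_mul]
      rfl
    simp only [toEuclideanLin_gen1]
    ext i
    rw [Subsingleton.elim i 0]
    refine (h2 t).trans ?_
    have h5 : (∫ s in (0 : ℝ)..t, γ • OU.coordAlong v (Y s.toNNReal ω)) 0 =
        γ * ∫ s in (0 : ℝ)..t, inner ℝ v (Y s.toNNReal ω) := h3.symm.trans h4
    simp only [PiLp.add_apply, PiLp.sub_apply, PiLp.smul_apply, h5, smul_eq_mul]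
    rw [mul_assoc]
    rfl

end OneDimensional

/-! ### Entropy production summed over the principal axes -/

section Entropy

variable {Ω : Type*} [MeasurableSpace Ω] {P : Measure Ω} [IsProbabilityMeasure P] {κ : ℝ}
  {d : ℕ} {Γ : Matrix (Fin d) (Fin d) ℝ} {y₀ : EuclideanSpace ℝ (Fin d)}
  {W Y : ℝ≥0 → Ω → EuclideanSpace ℝ (Fin d)} {t₁ t₂ : ℝ≥0}
  {e : OrthonormalBasis (Fin d) ℝ (EuclideanSpace ℝ (Fin d))} {γ : Fin d → ℝ}

lemma entropy_eq_sum_coordAlong (hκ : 0 < κ) (hΓ : Γ.PosDef)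
    (he : ∀ r, Matrix.toEuclideanLin Γ (e r) = γ r • e r) (ht₁ : 0 < t₁) (ht : t₁ < t₂)
    (y₀ : EuclideanSpace ℝ (Fin d)) (Y : ℝ≥0 → Ω → EuclideanSpace ℝ (Fin d)) (ω : Ω) :
    entropy κ Γ y₀ t₁ t₂ Y ω = ∑ r, entropy κ (gen1 (γ r)) (coordAlong (e r) y₀) t₁ t₂
      (fun t ω => coordAlong (e r) (Y t ω)) ω := by
  rw [entropy_eq_sum he hκ (eigenvalue_pos hΓ he) ht₁ ht]
  refine Finset.sum_congr rfl fun r _ => ?_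
  rw [entropy_gen1 hκ (eigenvalue_pos hΓ he r) ht₁ ht]
  rfl

lemma iIndepFun_entropy_coordAlong (hκ : 0 < κ) (hΓ : Γ.PosDef)
    (hY : IsOrnsteinUhlenbeck κ Γ y₀ W Y P)
    (he : ∀ r, Matrix.toEuclideanLin Γ (e r) = γ r • e r) (ht₁ : 0 < t₁) (ht : t₁ < t₂) :
    iIndepFun (fun r => entropy κ (gen1 (γ r)) (coordAlong (e r) y₀) t₁ t₂
      (fun t ω => coordAlong (e r) (Y t ω))) P := by
  refine (iIndepFun_entropy1 hκ hY he ht.le).congr fun r => ae_of_all _ fun ω => ?_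
  rw [entropy_gen1 hκ (eigenvalue_pos hΓ he r) ht₁ ht]
  rfl

theorem hasPDF_entropy (hd : 0 < d) (hκ : 0 < κ) (hΓ : Γ.PosDef)
    (hY : IsOrnsteinUhlenbeck κ Γ y₀ W Y P)
    (he : ∀ r, Matrix.toEuclideanLin Γ (e r) = γ r • e r) (ht₁ : 0 < t₁) (ht : t₁ < t₂) :
    HasPDF (entropy κ Γ y₀ t₁ t₂ Y) P volume := by
  have hγ := eigenvalue_pos hΓ he
  have hZ := fun r => hY.coordAlong (transpose_eq_self he) (e.orthonormal.1 r) (he r)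
  have hm := fun r => measurable_entropy_gen1 hκ (hγ r) (hZ r) ht₁ ht
  rw [funext (entropy_eq_sum_coordAlong hκ hΓ he ht₁ ht y₀ Y)]
  refine ⟨Finset.aemeasurable_fun_sum _ fun r _ => (hm r).aemeasurable, inferInstance, ?_⟩
  refine map_sum_absolutelyContinuous hd (iIndepFun_entropy_coordAlong hκ hΓ hY he ht₁ ht)
    (fun r => (hm r).aemeasurable) fun r => ?_
  exact (hasPDF_entropy_gen1 hκ (hγ r) (hZ r) ht₁ ht).absolutelyContinuous

end Entropy

/-! ### The isotropic case -/

section Isotropic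

variable {κ θ t₁ t₂ : ℝ}

lemma parB_sq_sub_parA_sq (hκ : 0 < κ) (hθ : 0 < θ) (ht₁ : 0 < t₁) (ht : t₁ < t₂) :
    parB κ θ t₁ t₂ ^ 2 - parA κ θ t₂ ^ 2 =
      (1 - q κ θ t₂) / (q κ θ t₂ * (q κ θ t₁ - q κ θ t₂)) := by
  have h1 := q_lt_one hκ hθ (ht₁.trans ht)
  have h2 := q_pos κ θ t₂
  have h3 := q_lt_q hκ hθ ht
  rw [parB, Real.sq_sqrt, parA]
  · ring
  · have := sub_pos.2 h1
    have := sub_pos.2 h3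
    positivity

/-- This is where `a` and `b` come from: the denominator in the `K` moment-generating function is
`D` up to a constant, which cancels in the ratio. -/
lemma parB_sq_sub_parA_sq_sub (hκ : 0 < κ) (hθ : 0 < θ) (ht₁ : 0 < t₁) (ht : t₁ < t₂) (l : ℝ) :
    parB κ θ t₁ t₂ ^ 2 - parA κ θ t₂ ^ 2 - (2 * parA κ θ t₂ * l + l ^ 2) =
      (parB κ θ t₁ t₂ ^ 2 - parA κ θ t₂ ^ 2) * quadD κ θ t₁ t₂ l := by
  have h1 := (sub_pos.2 (q_lt_one hκ hθ (ht₁.trans ht))).ne'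
  have h2 := (q_pos κ θ t₂).ne'
  have h3 := (sub_pos.2 (q_lt_q hκ hθ ht)).ne'
  rw [parB_sq_sub_parA_sq hκ hθ ht₁ ht, parA, quadD]
  field_simp
  ring

lemma exists_quadD_pos (κ θ t₁ t₂ : ℝ) :
    ∃ ε > 0, ∀ l ∈ Set.Ioo (-ε) ε, 0 < quadD κ θ t₁ t₂ l := by
  have hc : Continuous (quadD κ θ t₁ t₂) := by
    unfold quadD
    fun_prop
  have h0 : 0 < quadD κ θ t₁ t₂ 0 := by simp [quadD]
  obtain ⟨ε, hε, h⟩ := Metric.eventually_nhds_iff_ball.1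
    (hc.continuousAt.eventually (lt_mem_nhds h0))
  refine ⟨ε, hε, fun l hl => h l ?_⟩
  rwa [Real.ball_eq_Ioo, zero_sub, zero_add]

/-- The law with the moment-generating function of the isotropic case is the `K`-distribution. -/
theorem eq_withDensity_kDensity_of_mgf {d : ℕ} (hd : 0 < d) (hκ : 0 < κ) (hθ : 0 < θ)
    (ht₁ : 0 < t₁) (ht : t₁ < t₂) {μ : Measure ℝ} [IsFiniteMeasure μ]
    (h : ∀ l, 0 < quadD κ θ t₁ t₂ l → Integrable (fun x => Real.exp (l * x)) μ ∧
      mgf id μ l = mgf1 κ θ 0 t₁ t₂ l ^ d) :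
    μ = volume.withDensity fun x => ENNReal.ofReal
      (kDensity (((d : ℝ) - 1) / 2) (parA κ θ t₂) (parB κ θ t₁ t₂)
        (x - (d : ℝ) / 2 * Real.log ((1 - q κ θ t₂) / (1 - q κ θ t₁)))) := by
  have hq1 := sub_pos.2 (q_lt_one hκ hθ ht₁)
  have hq2 := sub_pos.2 (q_lt_one hκ hθ (ht₁.trans ht))
  have hq12 := sub_pos.2 (q_lt_q hκ hθ ht)
  have hq := q_pos κ θ t₂
  have hd' : (0 : ℝ) < d := Nat.cast_pos.2 hd
  have hν : ((d : ℝ) - 1) / 2 + 1 / 2 = d / 2 := by ring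
  have hν' : 0 < ((d : ℝ) - 1) / 2 + 1 / 2 := by rw [hν]; positivity
  have hc : 0 < parB κ θ t₁ t₂ ^ 2 - parA κ θ t₂ ^ 2 := by
    rw [parB_sq_sub_parA_sq hκ hθ ht₁ ht]
    positivity
  have hb : 0 < parB κ θ t₁ t₂ := by
    unfold parB
    positivity
  set s := (d : ℝ) / 2 * Real.log ((1 - q κ θ t₂) / (1 - q κ θ t₁)) with hs
  -- From the origin the exponential factor of `mgf1` is `1`; its `d`-th power is the shift factor
  -- `e^{l s}` times `D(l)^{-d/2}`.
  have hL : ∀ l, 0 < quadD κ θ t₁ t₂ l →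
      ∫⁻ x, ENNReal.ofReal (Real.exp (l * x)) ∂(volume.withDensity fun x => ENNReal.ofReal
        (kDensity (((d : ℝ) - 1) / 2) (parA κ θ t₂) (parB κ θ t₁ t₂) (x - s))) =
      ENNReal.ofReal (mgf1 κ θ 0 t₁ t₂ l ^ d) := by
    intro l hl
    rw [lintegral_exp_mul_kDensity_sub hν' hb (sub_pos.1 hc) s (by
      rw [parB_sq_sub_parA_sq_sub hκ hθ ht₁ ht]
      positivity), parB_sq_sub_parA_sq_sub hκ hθ ht₁ ht, hν]
    congr 1
    have h1 : (parB κ θ t₁ t₂ ^ 2 - parA κ θ t₂ ^ 2) /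
        ((parB κ θ t₁ t₂ ^ 2 - parA κ θ t₂ ^ 2) * quadD κ θ t₁ t₂ l) =
          (quadD κ θ t₁ t₂ l)⁻¹ := by
      field_simp
    have h2 : mgf1 κ θ 0 t₁ t₂ l = ((1 - q κ θ t₂) / (1 - q κ θ t₁)) ^ (l / 2) *
        quadD κ θ t₁ t₂ l ^ (-(1 / 2) : ℝ) := by
      simp [mgf1]
    rw [h1, h2, mul_pow, ← Real.rpow_mul_natCast (by positivity),
      ← Real.rpow_mul_natCast hl.le, Real.inv_rpow hl.le, ← Real.rpow_neg hl.le, hs,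
      Real.rpow_def_of_pos (by positivity) (l / 2 * d)]
    ring_nf
  -- At `l = 0` the formula gives the total mass, hence finiteness of the candidate law.
  have hmass := hL 0 (by simp [quadD])
  have : IsFiniteMeasure (volume.withDensity fun x => ENNReal.ofReal
      (kDensity (((d : ℝ) - 1) / 2) (parA κ θ t₂) (parB κ θ t₁ t₂) (x - s))) := by
    refine ⟨?_⟩
    simp only [zero_mul, Real.exp_zero, ENNReal.ofReal_one, lintegral_one] at hmass
    rw [hmass]
    exact ENNReal.ofReal_lt_top
  obtain ⟨ε, hε, hD⟩ := exists_quadD_pos κ θ t₁ t₂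
  have hk : ∀ l ∈ Set.Ioo (-ε) ε, _ := fun l hl =>
    integrable_and_integral_eq_of_lintegral (by fun_prop) (fun x => (Real.exp_pos _).le)
      (by
        have := hD l hl
        unfold mgf1
        positivity) (hL l (hD l hl))
  exact ext_of_mgf_eq_near_zero hε (fun l hl => (h l (hD l hl)).1) (fun l hl => (hk l hl).1)
    fun l hl => (h l (hD l hl)).2.trans (hk l hl).2.symm

end Isotropic

/-- For `θ I` every orthonormal basis is principal. In the standard one all axes carry the same
one-dimensional law, whence the `d`-th power. -/
theorem map_entropy_isotropic {Ω : Type*} [MeasurableSpace Ω] {P : Measure Ω}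
    [IsProbabilityMeasure P] {d : ℕ} (hd : 0 < d) {κ θ : ℝ} (hκ : 0 < κ)
    (hΓ : (θ • (1 : Matrix (Fin d) (Fin d) ℝ)).PosDef) {t₁ t₂ : ℝ≥0} (ht₁ : 0 < t₁) (ht : t₁ < t₂)
    {W Y : ℝ≥0 → Ω → EuclideanSpace ℝ (Fin d)}
    (hY : IsOrnsteinUhlenbeck κ (θ • (1 : Matrix (Fin d) (Fin d) ℝ)) 0 W Y P) :
    P.map (entropy κ (θ • (1 : Matrix (Fin d) (Fin d) ℝ)) 0 t₁ t₂ Y) =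
      volume.withDensity fun x => ENNReal.ofReal
        (kDensity (((d : ℝ) - 1) / 2) (parA κ θ t₂) (parB κ θ t₁ t₂)
          (x - (d : ℝ) / 2 * Real.log ((1 - q κ θ t₂) / (1 - q κ θ t₁)))) := by
  set e := EuclideanSpace.basisFun (Fin d) ℝ
  have he : ∀ r, Matrix.toEuclideanLin (θ • (1 : Matrix (Fin d) (Fin d) ℝ)) (e r) = θ • e r :=
    fun r => by simp
  have hθ : 0 < θ := eigenvalue_pos hΓ (γ := fun _ => θ) he ⟨0, hd⟩
  have hZ := fun r => hY.coordAlong (transpose_eq_self (γ := fun _ => θ) he) (e.orthonormal.1 r)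
    (he r)
  have hm := fun r => measurable_entropy_gen1 hκ hθ (hZ r) ht₁ ht
  have hi := iIndepFun_entropy_coordAlong (γ := fun _ => θ) hκ hΓ hY he ht₁ ht
  have hsum := funext (entropy_eq_sum_coordAlong (γ := fun _ => θ) hκ hΓ he ht₁ ht 0 Y)
  have hmS : Measurable (entropy κ (θ • (1 : Matrix (Fin d) (Fin d) ℝ)) 0 t₁ t₂ Y) := by
    rw [hsum]
    exact Finset.measurable_fun_sum _ fun r _ => hm r
  have := Measure.isProbabilityMeasure_map (μ := P) hmS.aemeasurable
  refine eq_withDensity_kDensity_of_mgf hd hκ hθ (NNReal.coe_pos.2 ht₁) (NNReal.coe_lt_coe.2 ht)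
    fun l hl => ?_
  have h1 := fun r => integrable_and_mgf_entropy_gen1 hκ hθ (hZ r) ht₁ ht hl
  rw [mgf_id_map hmS.aemeasurable, integrable_map_measure (by fun_prop) hmS.aemeasurable]
  constructor
  · rw [hsum]
    simpa [Function.comp_def] using
      hi.integrable_exp_mul_sum hm (s := Finset.univ) fun r _ => (h1 r).1
  · have h2 := hi.mgf_sum hm Finset.univ (t := l)
    rw [Finset.prod_congr rfl fun r _ => (h1 r).2] at h2
    rw [hsum]
    convert! h2 using 1
    · congr with ω
      simp
    · simp [coordAlong]

end OU

end

theorem proposition3 {d : ℕ} (hd : 0 < d) (κ : ℝ) (hκ : 0 < κ) (t₁ t₂ : ℝ≥0) (ht₁ : 0 < t₁)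
    (ht : t₁ < t₂) (Γ : Matrix (Fin d) (Fin d) ℝ) (hΓ : Γ.PosDef) (y₀ : EuclideanSpace ℝ (Fin d))
    {Ω : Type*} [MeasurableSpace Ω] (P : Measure Ω) [IsProbabilityMeasure P]
    (W Y : ℝ≥0 → Ω → EuclideanSpace ℝ (Fin d)) (hY : OU.IsOrnsteinUhlenbeck κ Γ y₀ W Y P) :
    -- `transDensity` is the density of the process, for every starting point
    (∀ t : ℝ≥0, 0 < t → P.map (Y t) =
      volume.withDensity (fun y => ENNReal.ofReal (OU.transDensity κ Γ t y₀ y))) ∧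
    -- the entropy production has a density
    HasPDF (OU.entropy κ Γ y₀ t₁ t₂ Y) P volume ∧
    -- principal axes: any orthonormal basis `e` of eigenvectors of `Γ`, with eigenvalues `γ`
    (∀ (e : OrthonormalBasis (Fin d) ℝ (EuclideanSpace ℝ (Fin d))) (γ : Fin d → ℝ),
      (∀ r, Matrix.toEuclideanLin Γ (e r) = γ r • e r) →
      -- decomposition into independent one-dimensional models along the principal axes
      ((∀ r, OU.IsOrnsteinUhlenbeck κ (OU.gen1 (γ r)) (OU.coordAlong (e r) y₀)
          (fun t ω => OU.coordAlong (e r) (W t ω)) (fun t ω => OU.coordAlong (e r) (Y t ω)) P) ∧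
        iIndepFun (fun r => OU.entropy κ (OU.gen1 (γ r)) (OU.coordAlong (e r) y₀) t₁ t₂
          (fun t ω => OU.coordAlong (e r) (Y t ω))) P ∧
        ∀ ω, OU.entropy κ Γ y₀ t₁ t₂ Y ω =
          ∑ r, OU.entropy κ (OU.gen1 (γ r)) (OU.coordAlong (e r) y₀) t₁ t₂
            (fun t ω => OU.coordAlong (e r) (Y t ω)) ω) ∧
      -- convolution of the laws, and product of the moment-generating functions, of arbitrary
      -- one-dimensional models with the parameters of the principal axes
      (∀ (Ω' : Fin d → Type*) [∀ r, MeasurableSpace (Ω' r)] (P' : ∀ r, Measure (Ω' r))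
        [∀ r, IsProbabilityMeasure (P' r)] (W' Z : ∀ r, ℝ≥0 → Ω' r → EuclideanSpace ℝ (Fin 1)),
        (∀ r, OU.IsOrnsteinUhlenbeck κ (OU.gen1 (γ r)) (OU.coordAlong (e r) y₀)
          (W' r) (Z r) (P' r)) →
        (∀ r, HasPDF (OU.entropy κ (OU.gen1 (γ r)) (OU.coordAlong (e r) y₀) t₁ t₂ (Z r))
          (P' r) volume) ∧
        P.map (OU.entropy κ Γ y₀ t₁ t₂ Y) =
          OU.convolution (fun r => (P' r).map
            (OU.entropy κ (OU.gen1 (γ r)) (OU.coordAlong (e r) y₀) t₁ t₂ (Z r))) ∧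
        (∀ z : ℂ, (∀ r, 0 < OU.quadD κ (γ r) t₁ t₂ z.re) →
          Integrable (fun ω => Complex.exp (z * (OU.entropy κ Γ y₀ t₁ t₂ Y ω : ℂ))) P ∧
          complexMGF (OU.entropy κ Γ y₀ t₁ t₂ Y) P z =
            ∏ r, complexMGF (OU.entropy κ (OU.gen1 (γ r)) (OU.coordAlong (e r) y₀) t₁ t₂ (Z r))
              (P' r) z) ∧
        (∀ r, ∀ l : ℝ, 0 < OU.quadD κ (γ r) t₁ t₂ l →
          Integrable (fun ω => Real.exp (l *
            OU.entropy κ (OU.gen1 (γ r)) (OU.coordAlong (e r) y₀) t₁ t₂ (Z r) ω)) (P' r) ∧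
          mgf (OU.entropy κ (OU.gen1 (γ r)) (OU.coordAlong (e r) y₀) t₁ t₂ (Z r)) (P' r) l =
            OU.mgf1 κ (γ r) (inner ℝ (e r) y₀) t₁ t₂ l))) ∧
    -- the isotropic case started at the origin
    (∀ θ : ℝ, Γ = θ • (1 : Matrix (Fin d) (Fin d) ℝ) → y₀ = 0 →
      P.map (OU.entropy κ Γ y₀ t₁ t₂ Y) = volume.withDensity (fun x => ENNReal.ofReal
        (OU.kDensity (((d : ℝ) - 1) / 2) (OU.parA κ θ t₂) (OU.parB κ θ t₁ t₂)
          (x - (d : ℝ) / 2 *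
            Real.log ((1 - Real.exp (-2 * θ * κ * t₂)) / (1 - Real.exp (-2 * θ * κ * t₁))))))) := by
  -- The first two claims mention no basis, so one is supplied by the spectral theorem.
  have he : ∀ r, Matrix.toEuclideanLin Γ (hΓ.1.eigenvectorBasis r) =
      hΓ.1.eigenvalues r • hΓ.1.eigenvectorBasis r := fun r => by
    ext i
    exact congrFun (hΓ.1.mulVec_eigenvectorBasis r) i
  refine ⟨fun t ht => OU.map_eq_withDensity_transDensity hκ hΓ hY he ht,
    OU.hasPDF_entropy hd hκ hΓ hY he ht₁ ht, fun e γ he => ?_, ?_⟩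
  · have hγ := OU.eigenvalue_pos hΓ he
    have hZ := fun r =>
      hY.coordAlong (OU.transpose_eq_self he) (e.orthonormal.1 r) (he r)
    have hi := OU.iIndepFun_entropy_coordAlong hκ hΓ hY he ht₁ ht
    have hsum := OU.entropy_eq_sum_coordAlong hκ hΓ he ht₁ ht y₀ Y
    have hm := fun r => OU.measurable_entropy_gen1 hκ (hγ r) (hZ r) ht₁ ht
    refine ⟨⟨hZ, hi, hsum⟩, fun Ω' _ P' _ W' Z hZ' => ?_⟩
    have hm' := fun r => OU.measurable_entropy_gen1 hκ (hγ r) (hZ' r) ht₁ ht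
    -- The law depends only on `κ`, `γ r`, the starting point and the two times, so each projected
    -- process may be exchanged for an arbitrary model with these parameters.
    have hlaw := fun r => (OU.map_entropy_gen1 hκ (hγ r) (hZ r) ht₁ ht).trans
      (OU.map_entropy_gen1 hκ (hγ r) (hZ' r) ht₁ ht).symm
    refine ⟨fun r => OU.hasPDF_entropy_gen1 hκ (hγ r) (hZ' r) ht₁ ht, ?_, fun z hz => ⟨?_, ?_⟩,
      fun r l hl => OU.integrable_and_mgf_entropy_gen1 hκ (hγ r) (hZ' r) ht₁ ht hl⟩
    · rw [funext hsum, OU.map_sum_eq_convolution hi fun r => (hm r).aemeasurable]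
      exact congrArg OU.convolution (funext hlaw)
    · rw [funext hsum]
      exact OU.integrable_cexp_mul_sum hi hm fun r =>
        (OU.integrable_and_mgf_entropy_gen1 hκ (hγ r) (hZ r) ht₁ ht (hz r)).1
    · rw [funext hsum, OU.complexMGF_sum hi fun r => (hm r).aemeasurable]
      refine Finset.prod_congr rfl fun r _ => ?_
      rw [← complexMGF_id_map (hm r).aemeasurable, hlaw r, complexMGF_id_map (hm' r).aemeasurable]
  · rintro θ rfl rfl
    exact OU.map_entropy_isotropic hd hκ hΓ ht₁ ht hY
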